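/- Let $n\ge 2$ and $d\ge 1$, and let $f\in\mathbb C[x_0,\dots,x_n]$ be a reduced homogeneous polynomial of degree $d$. Put $Y=\{f=0\}\subset\mathbb P^n_{\mathbb C}$ and $U=\mathbb P^n\setminus Y$. Let $\Omega^\bullet$ be the complex of algebraic differential forms on $\mathbb A^{n+1}$, graded by giving $x_i$ and $dx_i$ degree $1$; let $\Omega^\bullet[f^{-1}]$ be its localization and $\Omega^\bullet[f^{-1}]_0$ the part of degree $0$. Let $\xi=\frac1d\sum_i x_i\,\partial/\partial x_i$, with interior product $\iota_\xi$, and let $$\Omega^j[f^{-1}]_0^{(\xi)}=\mathrm{Im}\bigl(\iota_\xi:\Omega^{j+1}[f^{-1}]_0\to\Omega^j[f^{-1}]_0\bigr).$$ Let $\frac{df}{f}\wedge\Omega^\bullet[f^{-1}]_0^{(\xi)}$ be the complex whose term in degree $j$ is $\frac{df}{f}\wedge\Omega^j[f^{-1}]_0^{(\xi)}\subset\Omega^{j+1}[f^{-1}]_0$, with differential $\frac{df}{f}\wedge\omega\mapsto\frac{df}{f}\wedge d\omega$. Let $$\mathcal H_f=\Omega^{n+1}/\,df\wedge d\Omega^{n-1},$$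 and let $\mathcal H_{f,k}$ be its degree $k$ part, i.e. the image in $\mathcal H_f$ of the degree $k$ part of $\Omega^{n+1}$. **Proposition.** There are canonical isomorphisms of $\mathbb C$-vector spaces $$H^n\bigl(\Gamma(U,\Omega_U^\bullet)\bigr)\;\cong\; H^n\Bigl(\tfrac{df}{f}\wedge\Omega^\bullet[f^{-1}]_0^{(\xi)}\Bigr)\;\cong\;\varinjlim_{k\in\mathbb N}\mathcal H_{f,kd},$$ where the transition maps $\mathcal H_{f,kd}\to\mathcal H_{f,(k+1)d}$ of the direct limit are given by multiplication by $f$. The first isomorphism sends the class of a closed form $\omega\in\Gamma(U,\Omega^n_U)$ to the class of $\frac{df}{f}\wedge\pi^*\omega$, where $\pi^*$ is the pull-back of forms by the projection $\pi:\mathbb A^{n+1}\setminus\{f=0\}\to U$, and $\pi^*\omega\in\Omega^n[f^{-1}]_0^{(\xi)}$. Under the second isomorphism, the class of $\eta/f^k$, for $\eta\in\Omega^{n+1}$ of degree $kd$, corresponds to the image in the limit of the class of $\eta$ in $\mathcal H_{f,kd}$. -/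

import Mathlib

open scoped KaehlerDifferential

noncomputable section

namespace DeRham

section Forms

variable (k A : Type*) [CommRing k] [CommRing A] [Algebra k A]

/-- The exterior algebra `⋀_A Ω_{A/k}` of algebraic differential forms of a `k`-algebra `A`.
Its degree `j` part is the submodule `⋀[A]^j Ω[A⁄k]`. -/
abbrev Forms : Type _ := ExteriorAlgebra A (Ω[A⁄k])

/-- The one-form `da`. -/
def dOf (a : A) : Forms k A := ExteriorAlgebra.ι A (KaehlerDifferential.D k A a)

/-- Auxiliary: pairs `(ω, η)` of forms, with the twisted `A`-module structure
`a • (ω, η) = (a ω, a η + da ∧ ω)`. The map `ω ↦ (ω, dω)` is `A`-linear for this structure, which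
is how the exterior derivative is constructed below. -/
@[ext]
structure Jet where
  fst : Forms k A
  snd : Forms k A

def Jet.equiv : Jet k A ≃ Forms k A × Forms k A where
  toFun x := (x.fst, x.snd)
  invFun x := ⟨x.1, x.2⟩
  left_inv _ := rfl
  right_inv _ := rfl

instance Jet.addCommGroup : AddCommGroup (Jet k A) := (Jet.equiv k A).addCommGroup

variable {k A}

@[simp] lemma Jet.add_fst (x y : Jet k A) : (x + y).fst = x.fst + y.fst := rfl
@[simp] lemma Jet.add_snd (x y : Jet k A) : (x + y).snd = x.snd + y.snd := rfl
@[simp] lemma Jet.zero_fst : (0 : Jet k A).fst = 0 := rfl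
@[simp] lemma Jet.zero_snd : (0 : Jet k A).snd = 0 := rfl

lemma dOf_mul (a b : A) : dOf k A (a * b) = a • dOf k A b + b • dOf k A a := by
  simp [dOf]

lemma dOf_add (a b : A) : dOf k A (a + b) = dOf k A a + dOf k A b := by
  simp [dOf]

instance Jet.module : Module A (Jet k A) where
  smul a x := ⟨a • x.1, a • x.2 + dOf k A a * x.1⟩
  one_smul x := by
    refine Jet.ext (one_smul A x.1) ?_
    change (1 : A) • x.2 + dOf k A 1 * x.1 = x.2
    simp [dOf]
  mul_smul a b x := by
    refine Jet.ext (mul_smul a b x.1) ?_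
    change (a * b) • x.2 + dOf k A (a * b) * x.1
      = a • (b • x.2 + dOf k A b * x.1) + dOf k A a * (b • x.1)
    simp only [dOf_mul, add_mul, smul_mul_assoc, mul_smul_comm, smul_add, mul_smul]
    abel
  smul_zero a := by
    refine Jet.ext (smul_zero a) ?_
    change a • (0 : Forms k A) + dOf k A a * (0 : Forms k A) = 0
    simp
  smul_add a x y := by
    refine Jet.ext (smul_add a x.1 y.1) ?_
    change a • (x.2 + y.2) + dOf k A a * (x.1 + y.1)
      = (a • x.2 + dOf k A a * x.1) + (a • y.2 + dOf k A a * y.1)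
    rw [smul_add, mul_add]
    abel
  add_smul a b x := by
    refine Jet.ext (add_smul a b x.1) ?_
    change (a + b) • x.2 + dOf k A (a + b) * x.1
      = (a • x.2 + dOf k A a * x.1) + (b • x.2 + dOf k A b * x.1)
    rw [add_smul, dOf_add, add_mul]
    abel
  zero_smul x := by
    refine Jet.ext (zero_smul A x.1) ?_
    change (0 : A) • x.2 + dOf k A 0 * x.1 = 0
    simp [dOf]

instance Jet.baseModule : Module k (Jet k A) := Module.compHom (Jet k A) (algebraMap k A)

instance Jet.isScalarTower : IsScalarTower k A (Jet k A) where
  smul_assoc c a x := by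
    change (c • a) • x = algebraMap k A c • (a • x)
    rw [Algebra.smul_def, mul_smul]

@[simp] lemma Jet.smul_fst (a : A) (x : Jet k A) : (a • x).1 = a • x.1 := rfl
@[simp] lemma Jet.smul_snd (a : A) (x : Jet k A) : (a • x).2 = a • x.2 + dOf k A a * x.1 := rfl

lemma ι_anticomm (m m' : Ω[A⁄k]) :
    ExteriorAlgebra.ι A m * ExteriorAlgebra.ι A m'
      = -(ExteriorAlgebra.ι A m' * ExteriorAlgebra.ι A m) :=
  eq_neg_of_add_eq_zero_left (ExteriorAlgebra.ι_add_mul_swap m m')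

/-- The derivation `a ↦ (da, 0)`. -/
def jetDerivation : Derivation k A (Jet k A) where
  toFun a := ⟨dOf k A a, 0⟩
  map_add' a b := by
    ext
    · exact dOf_add a b
    · simp
  map_smul' c a := by
    change (⟨dOf k A (c • a), 0⟩ : Jet k A) = algebraMap k A c • (⟨dOf k A a, 0⟩ : Jet k A)
    ext
    · rw [Jet.smul_fst, algebraMap_smul]
      simp [dOf]
    · rw [Jet.smul_snd]
      simp [dOf]
  map_one_eq_zero' := by
    ext <;> simp [dOf]
  leibniz' a b := by
    ext
    · simp [dOf_mul]
    · simp [dOf, ExteriorAlgebra.ι_add_mul_swap]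

variable (k A) in
/-- The `A`-linear map `m ↦ (m, dm)` on one-forms, `a db ↦ (a db, da ∧ db)`. -/
def jetOne : Ω[A⁄k] →ₗ[A] Jet k A := jetDerivation.liftKaehlerDifferential

lemma jetOne_D (a : A) : jetOne k A (KaehlerDifferential.D k A a) = ⟨dOf k A a, 0⟩ :=
  Derivation.liftKaehlerDifferential_comp_D _ _

@[elab_as_elim]
lemma kaehler_induction {P : Ω[A⁄k] → Prop} (m : Ω[A⁄k])
    (zero : P 0) (add : ∀ x y, P x → P y → P (x + y))
    (smul : ∀ (a b : A), P (a • KaehlerDifferential.D k A b)) : P m := by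
  have hm : m ∈ Submodule.span A (Set.range (KaehlerDifferential.D k A)) := by
    rw [KaehlerDifferential.span_range_derivation]; trivial
  induction hm using Submodule.closure_induction with
  | zero => exact zero
  | add x y _ _ hx hy => exact add x y hx hy
  | smul_mem a x hx =>
    obtain ⟨b, rfl⟩ := hx
    exact smul a b

lemma jetOne_fst (m : Ω[A⁄k]) : (jetOne k A m).1 = ExteriorAlgebra.ι A m := by
  induction m using kaehler_induction with
  | zero => simp
  | add x y hx hy => simp [hx, hy]
  | smul a b => simp [jetOne_D, dOf]

lemma jetOne_snd_smul_D (a b : A) :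
    (jetOne k A (a • KaehlerDifferential.D k A b)).2 = dOf k A a * dOf k A b := by
  simp [jetOne_D]

lemma jetOne_snd_comm (m m' : Ω[A⁄k]) :
    ExteriorAlgebra.ι A m' * (jetOne k A m).2 = (jetOne k A m).2 * ExteriorAlgebra.ι A m' := by
  induction m using kaehler_induction with
  | zero => simp
  | add x y hx hy => simp [hx, hy, mul_add, add_mul]
  | smul a b =>
    rw [jetOne_snd_smul_D, dOf, dOf, ← mul_assoc, ι_anticomm, neg_mul, mul_assoc, ι_anticomm m',
      mul_neg, neg_neg, mul_assoc]

variable (k A) in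
/-- `m ↦ ((ω, η) ↦ (m ∧ ω, dm ∧ ω - m ∧ η))`. -/
def jetFold : Ω[A⁄k] →ₗ[A] Jet k A →ₗ[A] Jet k A :=
  LinearMap.mk₂ A
    (fun m x => ⟨ExteriorAlgebra.ι A m * x.1,
      (jetOne k A m).2 * x.1 - ExteriorAlgebra.ι A m * x.2⟩)
    (fun m m' x => by
      ext
      · simp [add_mul]
      · simp only [map_add, Jet.add_snd, add_mul]; abel)
    (fun a m x => by
      ext
      · simp
      · simp only [map_smul, Jet.smul_snd, jetOne_fst, add_mul, smul_mul_assoc, smul_sub, mul_assoc]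
        abel)
    (fun m x y => by
      ext
      · simp [mul_add]
      · simp only [Jet.add_snd, Jet.add_fst, mul_add]; abel)
    (fun a m x => by
      ext
      · simp
      · simp only [Jet.smul_snd, Jet.smul_fst, mul_add, mul_smul_comm, smul_sub, dOf, ← mul_assoc]
        rw [ι_anticomm m, neg_mul]
        abel)

lemma jetFold_jetFold (m : Ω[A⁄k]) (x : Jet k A) : jetFold k A m (jetFold k A m x) = 0 := by
  ext
  · simp [jetFold, ← mul_assoc]
  · simp only [jetFold, LinearMap.mk₂_apply, mul_sub, ← mul_assoc, jetOne_snd_comm]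
    simp

variable (k A) in
/-- The `A`-linear map `ω ↦ (ω, dω)` on all forms. -/
def jetLift : Forms k A →ₗ[A] Jet k A :=
  CliffordAlgebra.foldr 0 (jetFold k A) (fun m x => by simp [jetFold_jetFold]) ⟨1, 0⟩

lemma jetLift_ι_mul (m : Ω[A⁄k]) (x : Forms k A) :
    jetLift k A (ExteriorAlgebra.ι A m * x) = jetFold k A m (jetLift k A x) := by
  unfold jetLift ExteriorAlgebra.ι
  rw [CliffordAlgebra.foldr_mul, CliffordAlgebra.foldr_ι]

lemma jetLift_algebraMap (a : A) :
    jetLift k A (algebraMap A (Forms k A) a) = ⟨algebraMap A (Forms k A) a, dOf k A a⟩ := by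
  refine (CliffordAlgebra.foldr_algebraMap _ _ _ _ _).trans ?_
  ext
  · exact (Algebra.algebraMap_eq_smul_one a).symm
  · change a • (0 : Forms k A) + dOf k A a * 1 = _
    simp

lemma jetLift_fst (x : Forms k A) : (jetLift k A x).1 = x := by
  induction x using CliffordAlgebra.left_induction with
  | algebraMap r => exact congrArg Jet.fst (jetLift_algebraMap r)
  | add x y hx hy => rw [map_add, Jet.add_fst, hx, hy]
  | ι_mul x m hx =>
    refine (congrArg Jet.fst (jetLift_ι_mul m x)).trans ?_
    change ExteriorAlgebra.ι A m * (jetLift k A x).1 = _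
    rw [hx]

variable (k A) in
/-- The exterior derivative `d` on the algebraic differential forms of `A` over `k`. It is determined
by `formDeriv_algebraMap`, `formDeriv_smul` and `formDeriv_dOf_mul`, which give
`d (a db₁ ∧ ⋯ ∧ dbⱼ) = da ∧ db₁ ∧ ⋯ ∧ dbⱼ`. -/
def formDeriv : Forms k A →ₗ[k] Forms k A where
  toFun x := (jetLift k A x).2
  map_add' x y := by simp
  map_smul' c x := by
    rw [← algebraMap_smul A c x, map_smul, Jet.smul_snd]
    simp [dOf]

lemma formDeriv_algebraMap (a : A) : formDeriv k A (algebraMap A (Forms k A) a) = dOf k A a :=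
  congrArg Jet.snd (jetLift_algebraMap a)

lemma formDeriv_smul (a : A) (x : Forms k A) :
    formDeriv k A (a • x) = dOf k A a * x + a • formDeriv k A x := by
  change (jetLift k A (a • x)).2 = _
  rw [map_smul, Jet.smul_snd, jetLift_fst, add_comm]; rfl

lemma formDeriv_dOf_mul (a : A) (x : Forms k A) :
    formDeriv k A (dOf k A a * x) = -(dOf k A a * formDeriv k A x) := by
  change (jetLift k A (ExteriorAlgebra.ι A _ * x)).2 = _
  rw [jetLift_ι_mul]
  change (jetOne k A _).2 * (jetLift k A x).1 - _ = _
  rw [jetOne_D]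
  simp [dOf, formDeriv]

lemma formDeriv_formDeriv (x : Forms k A) : formDeriv k A (formDeriv k A x) = 0 := by
  induction x using CliffordAlgebra.left_induction with
  | algebraMap r =>
    change formDeriv k A (formDeriv k A (algebraMap A (Forms k A) r)) = 0
    rw [formDeriv_algebraMap, ← mul_one (dOf k A r), formDeriv_dOf_mul,
      ← map_one (algebraMap A (Forms k A)), formDeriv_algebraMap]
    simp [dOf]
  | add x y hx hy => rw [map_add, map_add, hx, hy, add_zero]
  | ι_mul x m hx =>
    change formDeriv k A (formDeriv k A (ExteriorAlgebra.ι A m * x)) = 0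
    induction m using kaehler_induction with
    | zero => simp
    | add y z hy hz => rw [map_add, add_mul, map_add, map_add, hy, hz, add_zero]
    | smul a b =>
      rw [map_smul, smul_mul_assoc]
      change formDeriv k A (formDeriv k A (a • (dOf k A b * x))) = 0
      rw [formDeriv_smul, map_add, formDeriv_dOf_mul, formDeriv_smul, formDeriv_dOf_mul, map_neg,
        formDeriv_dOf_mul, hx]
      simp

end Forms

section Functoriality

variable {k A B : Type*} [CommRing k] [CommRing A] [Algebra k A] [CommRing B] [Algebra k B]

/-- The map on differential forms (pullback) induced by a homomorphism of `k`-algebras `φ : A → B`: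
`a da₁ ∧ ⋯ ∧ daⱼ ↦ φ(a) dφ(a₁) ∧ ⋯ ∧ dφ(aⱼ)`. -/
def formsMap (φ : A →ₐ[k] B) : Forms k A →ₐ[k] Forms k B :=
  letI := φ.toRingHom.toAlgebra
  haveI : IsScalarTower k A B := .of_algebraMap_eq' φ.comp_algebraMap.symm
  (ExteriorAlgebra.lift A
    ⟨(ExteriorAlgebra.ι B).restrictScalars A ∘ₗ KaehlerDifferential.map k k A B,
      fun _ => ExteriorAlgebra.ι_sq_zero _⟩).restrictScalars k

lemma formsMap_algebraMap (φ : A →ₐ[k] B) (a : A) :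
    formsMap φ (algebraMap A (Forms k A) a) = algebraMap B (Forms k B) (φ a) := by
  let := φ.toRingHom.toAlgebra
  have : IsScalarTower k A B := .of_algebraMap_eq' φ.comp_algebraMap.symm
  exact AlgHom.commutes _ a

lemma formsMap_dOf (φ : A →ₐ[k] B) (a : A) : formsMap φ (dOf k A a) = dOf k B (φ a) := by
  let := φ.toRingHom.toAlgebra
  have : IsScalarTower k A B := .of_algebraMap_eq' φ.comp_algebraMap.symm
  refine (ExteriorAlgebra.lift_ι_apply _ _ _ _).trans ?_
  change ExteriorAlgebra.ι B (KaehlerDifferential.map k k A B _) = _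
  rw [KaehlerDifferential.map_D]
  rfl

end Functoriality

section Cohomology

variable {k E : Type*} [CommRing k] [AddCommGroup E] [Module k E]

/-- A complex is given here by its terms `C j`, as submodules of one ambient module `E`, and a
differential `δ` of `E` with `δ (C j) ⊆ C (j + 1)` and `δ ∘ δ = 0` on them. These are the cocycles in
degree `j`. -/
def cocycles (C : ℕ → Submodule k E) (δ : E →ₗ[k] E) (j : ℕ) : Submodule k E :=
  C j ⊓ LinearMap.ker δ

/-- The coboundaries in degree `j`, that is `δ (C (j - 1))`, and `0` for `j = 0`. -/
def coboundaries (C : ℕ → Submodule k E) (δ : E →ₗ[k] E) : ℕ → Submodule k E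
  | 0 => ⊥
  | j + 1 => (C j).map δ

/-- The cohomology `H^j(C)` of the complex `(C, δ)`: cocycles modulo coboundaries. -/
abbrev Cohomology (C : ℕ → Submodule k E) (δ : E →ₗ[k] E) (j : ℕ) : Type _ :=
  cocycles C δ j ⧸ (coboundaries C δ j).submoduleOf (cocycles C δ j)

/-- The cohomology class of a cocycle. -/
abbrev Cohomology.mk (C : ℕ → Submodule k E) (δ : E →ₗ[k] E) (j : ℕ) (x : cocycles C δ j) :
    Cohomology C δ j :=
  ((coboundaries C δ j).submoduleOf (cocycles C δ j)).mkQ x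

end Cohomology

section Projective

open AlgebraicGeometry CategoryTheory

/-- The polynomial ring `ℂ[x₀, …, xₙ]`. -/
abbrev Poly (n : ℕ) : Type := MvPolynomial (Fin (n + 1)) ℂ

/-- Its grading by the degree. -/
abbrev polyGrading (n : ℕ) : ℕ → Submodule ℂ (Poly n) :=
  MvPolynomial.homogeneousSubmodule (Fin (n + 1)) ℂ

instance polyGradedRing (n : ℕ) : GradedRing (polyGrading n) := MvPolynomial.gradedAlgebra

/-- The projective space `ℙⁿ` over `ℂ`, as `Proj ℂ[x₀, …, xₙ]`. -/
abbrev PP (n : ℕ) : Scheme := Proj (polyGrading n)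

/-- The structure morphism `ℙⁿ ⟶ Spec ℂ`. -/
def PP.toSpec (n : ℕ) : PP n ⟶ Spec (CommRingCat.of ℂ) :=
  Proj.toSpecZero (polyGrading n) ≫
    Spec.map (CommRingCat.ofHom (algebraMap ℂ (polyGrading n 0)))

/-- The `ℂ`-algebra structure of `Γ(V, 𝒪)` for `V ⊆ ℙⁿ` open, coming from the structure morphism. -/
instance PP.sectionsAlgebra (n : ℕ) (V : (PP n).Opens) : Algebra ℂ Γ(PP n, V) :=
  ((Scheme.ΓSpecIso (CommRingCat.of ℂ)).inv ≫ (PP.toSpec n).appTop ≫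
    (PP n).presheaf.map (homOfLE le_top).op).hom.toAlgebra

lemma PP.algebraMap_eq (n : ℕ) (V : (PP n).Opens) :
    algebraMap ℂ Γ(PP n, V) = ((Scheme.ΓSpecIso (CommRingCat.of ℂ)).inv ≫ (PP.toSpec n).appTop ≫
    (PP n).presheaf.map (homOfLE le_top).op).hom := rfl

/-- Restriction of functions, as a homomorphism of `ℂ`-algebras. -/
def PP.restrict {n : ℕ} {V W : (PP n).Opens} (h : W ≤ V) : Γ(PP n, V) →ₐ[ℂ] Γ(PP n, W) where
  __ := ((PP n).presheaf.map (homOfLE h).op).hom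
  commutes' c := by
    change ((PP n).presheaf.map (homOfLE h).op).hom (algebraMap ℂ Γ(PP n, V) c)
      = algebraMap ℂ Γ(PP n, W) c
    rw [PP.algebraMap_eq, PP.algebraMap_eq, ← CommRingCat.comp_apply, Category.assoc,
      Category.assoc, ← Functor.map_comp]
    rfl

/-- The affine open subschemes of an open `U ⊆ ℙⁿ`. -/
abbrev AffineIn {n : ℕ} (U : (PP n).Opens) : Type := {V : (PP n).Opens // IsAffineOpen V ∧ V ≤ U}

/-- Families of differential forms, one on each affine open of `U`. -/
abbrev FormFamily {n : ℕ} (U : (PP n).Opens) : Type := ∀ V : AffineIn U, Forms ℂ Γ(PP n, V.1)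

/-- The space `Γ(U, Ω_U^j)` of algebraic `j`-forms on an open `U ⊆ ℙⁿ`. As `Ω_U^j` is quasi-coherent
with sections `⋀^j Ω_{Γ(V, 𝒪)/ℂ}` on an affine open `V`, a global section is a family of elements
of these modules, one for each affine open `V ⊆ U`, that is compatible with restriction. -/
def openForms {n : ℕ} (U : (PP n).Opens) (j : ℕ) : Submodule ℂ (FormFamily U) where
  carrier := {ω | (∀ V, ω V ∈ ⋀[Γ(PP n, V.1)]^j (Ω[Γ(PP n, V.1)⁄ℂ])) ∧
    ∀ (V W : AffineIn U) (h : W.1 ≤ V.1), formsMap (PP.restrict h) (ω V) = ω W}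
  zero_mem' := ⟨fun _ => Submodule.zero_mem _, fun _ _ _ => map_zero _⟩
  add_mem' {ω η} hω hη := ⟨fun V => Submodule.add_mem _ (hω.1 V) (hη.1 V), fun V W h => by
    rw [Pi.add_apply, map_add, hω.2, hη.2, Pi.add_apply]⟩
  smul_mem' c ω hω := ⟨fun V => Submodule.smul_of_tower_mem _ c (hω.1 V), fun V W h => by
    rw [Pi.smul_apply, map_smul, hω.2, Pi.smul_apply]⟩

/-- The exterior derivative of the de Rham complex `Γ(U, Ω_U^•)`, computed on each affine open. -/
def openFormDeriv {n : ℕ} (U : (PP n).Opens) : FormFamily U →ₗ[ℂ] FormFamily U :=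
  LinearMap.pi fun V => formDeriv ℂ Γ(PP n, V.1) ∘ₗ LinearMap.proj V

/-- The open subscheme `U = ℙⁿ ∖ Y`, where `Y` is the zero locus of `f`: the points of `Proj` (homogeneous
prime ideals) that do not contain `f`. -/
abbrev hypersurfaceCompl {n : ℕ} (f : Poly n) : (PP n).Opens := Proj.basicOpen (polyGrading n) f

/-- The localization `ℂ[x₀, …, xₙ][f⁻¹]`, the ring of functions on the complement of `f = 0` in affine
`(n+1)`-space.

Its algebra of forms `Forms ℂ (PolyLoc f)` is the localization `Ω^•[f⁻¹]` of the algebra of forms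
on affine `(n+1)`-space. -/
abbrev PolyLoc {n : ℕ} (f : Poly n) : Type := Localization.Away f

lemma isAffineOpen_hypersurfaceCompl {n d : ℕ} {f : Poly n} (hf : f.IsHomogeneous d)
    (hd : 0 < d) : IsAffineOpen (hypersurfaceCompl f) :=
  Proj.isAffineOpen_basicOpen (polyGrading n) f hf hd

/-- The isomorphism `(ℂ[x][f⁻¹])₀ ≅ Γ(U, 𝒪)` respects constants. -/
lemma awayToSection_comp {n d : ℕ} {f : Poly n} (hf : f.IsHomogeneous d) (hd : 0 < d) :
    CommRingCat.ofHom (algebraMap ℂ (polyGrading n 0)) ≫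
      CommRingCat.ofHom (HomogeneousLocalization.fromZeroRingHom (polyGrading n)
        (Submonoid.powers f)) ≫ Proj.awayToSection (polyGrading n) f =
    (Scheme.ΓSpecIso (CommRingCat.of ℂ)).inv ≫ (PP.toSpec n).appTop ≫
      (PP n).presheaf.map (homOfLE (le_top : hypersurfaceCompl f ≤ ⊤)).op := by
  apply Spec.map_injective
  rw [← cancel_epi (isAffineOpen_hypersurfaceCompl hf hd).isoSpec.hom, IsAffineOpen.isoSpec_hom]
  simp only [Spec.map_comp, Category.assoc, Scheme.Opens.toSpecΓ_SpecMap_presheaf_map_top_assoc,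
    ← Scheme.toSpecΓ_naturality_assoc]
  have h1 : (hypersurfaceCompl f).toSpecΓ ≫ Spec.map (Proj.awayToSection (polyGrading n) f) =
    Proj.basicOpenToSpec (polyGrading n) f := rfl
  rw [reassoc_of% h1, ← Proj.basicOpenIsoSpec_hom (polyGrading n) f hf hd, PP.toSpec,
    ← Proj.awayι_toSpecZero_assoc (polyGrading n) f hf hd,
    ← Proj.basicOpenIsoSpec_inv_ι (polyGrading n) f hf hd]
  simp

/-- Pullback of functions along the projection `{f ≠ 0} → U`, `{f ≠ 0}` in affine `(n+1)`-space: the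
inclusion `Γ(U, 𝒪) = (ℂ[x][f⁻¹])₀ ⊆ ℂ[x][f⁻¹]`. -/
def sectionsToLoc {n d : ℕ} {f : Poly n} (hf : f.IsHomogeneous d) (hd : 0 < d) :
    Γ(PP n, hypersurfaceCompl f) →ₐ[ℂ] PolyLoc f where
  __ := (algebraMap (HomogeneousLocalization.Away (polyGrading n) f) (PolyLoc f)).comp
    (Proj.basicOpenIsoAway (polyGrading n) f hf hd).inv.hom
  commutes' c := by
    have h : algebraMap ℂ Γ(PP n, hypersurfaceCompl f) c =
        (Proj.basicOpenIsoAway (polyGrading n) f hf hd).hom.hom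
          (HomogeneousLocalization.fromZeroRingHom (polyGrading n) (Submonoid.powers f)
            (algebraMap ℂ (polyGrading n 0) c)) :=
      congrArg (fun g => g.hom c) (awayToSection_comp hf hd).symm
    change algebraMap (HomogeneousLocalization.Away (polyGrading n) f) (PolyLoc f)
      ((Proj.basicOpenIsoAway (polyGrading n) f hf hd).inv.hom
        (algebraMap ℂ Γ(PP n, hypersurfaceCompl f) c)) = _
    rw [h, ← CommRingCat.comp_apply, Iso.hom_inv_id]
    change (HomogeneousLocalization.fromZeroRingHom (polyGrading n) (Submonoid.powers f)
            (algebraMap ℂ (polyGrading n 0) c)).val = algebraMap ℂ (PolyLoc f) c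
    rfl

/-- `U` itself, as an affine open of `U`. -/
def affineTop {n d : ℕ} {f : Poly n} (hf : f.IsHomogeneous d) (hd : 0 < d) :
    AffineIn (hypersurfaceCompl f) :=
  ⟨hypersurfaceCompl f, isAffineOpen_hypersurfaceCompl hf hd, le_rfl⟩

/-- Pullback of differential forms along the projection `{f ≠ 0} → U`. -/
def pullbackForm {n d : ℕ} {f : Poly n} (hf : f.IsHomogeneous d) (hd : 0 < d)
    (ω : FormFamily (hypersurfaceCompl f)) : Forms ℂ (PolyLoc f) :=
  formsMap (sectionsToLoc hf hd) (ω (affineTop hf hd))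

end Projective

section Affine

variable {n : ℕ}

/-- The form `dx_{s 0} ∧ ⋯ ∧ dx_{s (j-1)}`. -/
def dxMonomial (A : Type*) [CommRing A] [Algebra ℂ A] [Algebra (Poly n) A] {j : ℕ}
    (s : Fin j → Fin (n + 1)) : Forms ℂ A :=
  ExteriorAlgebra.ιMulti A j
    fun i => KaehlerDifferential.D ℂ A (algebraMap (Poly n) A (MvPolynomial.X (s i)))

/-- The space `Ω^j` of algebraic `j`-forms on affine `(n+1)`-space. -/
def polyForms (n j : ℕ) : Submodule ℂ (Forms ℂ (Poly n)) :=
  (⋀[Poly n]^j (Ω[Poly n⁄ℂ])).restrictScalars ℂ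

/-- The degree `k` part of `Ω^j`, where `xᵢ` and `dxᵢ` have degree `1`: it is spanned by the
`g dx_{s 0} ∧ ⋯ ∧ dx_{s (j-1)}` with `g` homogeneous of degree `k - j`. -/
def polyFormsDeg (n j k : ℕ) : Submodule ℂ (Forms ℂ (Poly n)) :=
  Submodule.span ℂ {ω | ∃ (e : ℕ) (g : Poly n) (s : Fin j → Fin (n + 1)),
    g.IsHomogeneous e ∧ e + j = k ∧ ω = g • dxMonomial (Poly n) s}

/-- The element `f⁻¹` of `ℂ[x][f⁻¹]`. -/
def fInv (f : Poly n) : PolyLoc f := IsLocalization.Away.invSelf f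

/-- The degree `k` part `Ω^j[f⁻¹]_k` (`k` an integer, `f` homogeneous of degree `d`): it is spanned by the
`(g / f^m) dx_{s 0} ∧ ⋯ ∧ dx_{s (j-1)}` with `g` homogeneous and `deg g - m d + j = k`. -/
def locFormsDeg (f : Poly n) (d j : ℕ) (k : ℤ) : Submodule ℂ (Forms ℂ (PolyLoc f)) :=
  Submodule.span ℂ {ω | ∃ (e m : ℕ) (g : Poly n) (s : Fin j → Fin (n + 1)),
    g.IsHomogeneous e ∧ (e : ℤ) + j = k + m * d ∧
      ω = (algebraMap (Poly n) (PolyLoc f) g * fInv f ^ m) • dxMonomial (PolyLoc f) s}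

/-- The vector field `ξ = (1/d) ∑ xᵢ ∂ᵢ`. -/
def euler (n d : ℕ) : Derivation ℂ (Poly n) (Poly n) :=
  (d : ℂ)⁻¹ • ∑ i, (MvPolynomial.X i : Poly n) • MvPolynomial.pderiv i

lemma euler_apply_of_isHomogeneous {d k : ℕ} {g : Poly n} (hg : g.IsHomogeneous k) :
    euler n d g = ((k : ℂ) / d) • g := by
  have h : (∑ i, (MvPolynomial.X i : Poly n) • MvPolynomial.pderiv (R := ℂ) i) g = k • g := by
    rw [← hg.sum_X_mul_pderiv, ← Derivation.coeFnAddMonoidHom_apply, map_sum, Finset.sum_apply]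
    rfl
  rw [euler, Derivation.smul_apply, h, ← Nat.cast_smul_eq_nsmul ℂ, smul_smul]
  congr 1
  ring

/-- The vector field `ξ` on `{f ≠ 0}`, as a linear functional on one-forms: `dg ↦ ξ g`. -/
def eulerFunctional (f : Poly n) (d : ℕ) : Module.Dual (PolyLoc f) (Ω[PolyLoc f⁄ℂ]) :=
  haveI : Algebra.FormallyEtale (Poly n) (PolyLoc f) :=
    .of_isLocalization (Submonoid.powers f)
  (KaehlerDifferential.isBaseChange_of_formallyEtale ℂ (Poly n) (PolyLoc f)).lift
    (Algebra.linearMap (Poly n) (PolyLoc f) ∘ₗ (euler n d).liftKaehlerDifferential)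

lemma eulerFunctional_D (f : Poly n) (d : ℕ) (g : Poly n) :
    eulerFunctional f d (KaehlerDifferential.D ℂ (PolyLoc f) (algebraMap (Poly n) (PolyLoc f) g)) =
      algebraMap (Poly n) (PolyLoc f) (euler n d g) := by
  have : Algebra.FormallyEtale (Poly n) (PolyLoc f) := .of_isLocalization (Submonoid.powers f)
  have h := (KaehlerDifferential.isBaseChange_of_formallyEtale ℂ (Poly n) (PolyLoc f)).lift_eq
    (Algebra.linearMap (Poly n) (PolyLoc f) ∘ₗ (euler n d).liftKaehlerDifferential)
    (KaehlerDifferential.D ℂ (Poly n) g)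
  rw [KaehlerDifferential.map_D] at h
  refine h.trans ?_
  simp

/-- The interior product `ι_ξ` on `Ω^•[f⁻¹]`. -/
def eulerContraction (f : Poly n) (d : ℕ) : Forms ℂ (PolyLoc f) →ₗ[ℂ] Forms ℂ (PolyLoc f) :=
  (CliffordAlgebra.contractLeft (Q := (0 : QuadraticForm (PolyLoc f) (Ω[PolyLoc f⁄ℂ])))
    (eulerFunctional f d)).restrictScalars ℂ

/-- `Ω^j[f⁻¹]_0^{(ξ)}`, the image of `ι_ξ : Ω^{j+1}[f⁻¹]_0 → Ω^j[f⁻¹]_0`. -/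
def xiForms (f : Poly n) (d j : ℕ) : Submodule ℂ (Forms ℂ (PolyLoc f)) :=
  (locFormsDeg f d (j + 1) 0).map (eulerContraction f d)

/-- The logarithmic form `df/f`. -/
def dlog (f : Poly n) : Forms ℂ (PolyLoc f) :=
  fInv f • dOf ℂ (PolyLoc f) (algebraMap (Poly n) (PolyLoc f) f)

/-- The term `(df/f) ∧ Ω^j[f⁻¹]_0^{(ξ)}` of the complex `(df/f) ∧ Ω^•[f⁻¹]_0^{(ξ)}`. It consists of forms
of degree `j + 1` but is placed in degree `j`. The differential of the complex is
`(df/f) ∧ ω ↦ (df/f) ∧ dω`, which is the restriction of `-d`. -/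
def dlogXiForms (f : Poly n) (d j : ℕ) : Submodule ℂ (Forms ℂ (PolyLoc f)) :=
  (xiForms f d j).map (LinearMap.mulLeft ℂ (dlog f))

/-- `η ↦ η / f^k`, from `Ω^•` to `Ω^•[f⁻¹]`. -/
def divPow (f : Poly n) (k : ℕ) : Forms ℂ (Poly n) →ₗ[ℂ] Forms ℂ (PolyLoc f) :=
  (fInv f ^ k) • (formsMap (IsScalarTower.toAlgHom ℂ (Poly n) (PolyLoc f))).toLinearMap

/-- The subspace `df ∧ dΩ^{n-1}` of `Ω^{n+1}`. -/
def brieskornRel (f : Poly n) : Submodule ℂ (Forms ℂ (Poly n)) :=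
  (coboundaries (polyForms n) (formDeriv ℂ (Poly n)) n).map (LinearMap.mulLeft ℂ (dOf ℂ (Poly n) f))

/-- The algebraic Brieskorn module `H_f = Ω^{n+1} / df ∧ dΩ^{n-1}`. -/
abbrev Brieskorn (f : Poly n) : Type :=
  polyForms n (n + 1) ⧸ (brieskornRel f).submoduleOf (polyForms n (n + 1))

/-- The class of an `(n+1)`-form. -/
def Brieskorn.mk (f : Poly n) : polyForms n (n + 1) →ₗ[ℂ] Brieskorn f :=
  ((brieskornRel f).submoduleOf (polyForms n (n + 1))).mkQ

/-- The degree `k` part `H_{f,k}`: the classes of the `(n+1)`-forms of degree `k`. -/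
def Brieskorn.deg (f : Poly n) (k : ℕ) : Submodule ℂ (Brieskorn f) :=
  ((polyFormsDeg n (n + 1) k).submoduleOf (polyForms n (n + 1))).map (Brieskorn.mk f)

lemma smul_mem_brieskornRel (f : Poly n) {ω : Forms ℂ (Poly n)} (hω : ω ∈ brieskornRel f) :
    f • ω ∈ brieskornRel f := by
  obtain ⟨η, hη, rfl⟩ := hω
  cases n with
  | zero =>
    obtain rfl : η = 0 := by simpa [coboundaries] using hη
    simp
  | succ m =>
    obtain ⟨θ, hθ, rfl⟩ := hη
    refine ⟨formDeriv ℂ _ (f • θ), ⟨f • θ, ?_, rfl⟩, ?_⟩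
    · exact Submodule.smul_mem (⋀[Poly (m + 1)]^m (Ω[Poly (m + 1)⁄ℂ])) f hθ
    · simp only [LinearMap.mulLeft_apply, formDeriv_smul, mul_add, ← mul_assoc, mul_smul_comm]
      simp [dOf]

/-- Multiplication by `f` on `Ω^j`. -/
def polyFormsMulF (f : Poly n) (j : ℕ) : polyForms n j →ₗ[ℂ] polyForms n j :=
  ((LinearMap.lsmul (Poly n) (Forms ℂ (Poly n)) f).restrictScalars ℂ).restrict fun _ hω =>
    Submodule.smul_mem (⋀[Poly n]^j (Ω[Poly n⁄ℂ])) f hω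

/-- Multiplication by `f` on the Brieskorn module. -/
def Brieskorn.mulF (f : Poly n) : Brieskorn f →ₗ[ℂ] Brieskorn f :=
  Submodule.mapQ _ _ (polyFormsMulF f (n + 1)) fun _ hω => smul_mem_brieskornRel f hω

lemma smul_mem_polyFormsDeg {d : ℕ} {f : Poly n} (hf : f.IsHomogeneous d) {j k : ℕ}
    {ω : Forms ℂ (Poly n)} (hω : ω ∈ polyFormsDeg n j k) : f • ω ∈ polyFormsDeg n j (k + d) := by
  induction hω using Submodule.span_induction with
  | mem x hx =>
    obtain ⟨e, g, s, hg, rfl, rfl⟩ := hx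
    exact Submodule.subset_span ⟨d + e, f * g, s, hf.mul hg, by ring, by rw [mul_smul]⟩
  | zero => rw [smul_zero]; exact Submodule.zero_mem _
  | add x y _ _ hx hy => rw [smul_add]; exact Submodule.add_mem _ hx hy
  | smul c x _ hx => rw [smul_comm]; exact Submodule.smul_mem _ c hx

lemma Brieskorn.mulF_mem_deg {d : ℕ} {f : Poly n} (hf : f.IsHomogeneous d) {k : ℕ}
    {x : Brieskorn f} (hx : x ∈ Brieskorn.deg f k) :
    Brieskorn.mulF f x ∈ Brieskorn.deg f (k + d) := by
  obtain ⟨ω, hω, rfl⟩ := hx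
  exact ⟨polyFormsMulF f (n + 1) ω, smul_mem_polyFormsDeg hf hω, rfl⟩

lemma Brieskorn.mulF_pow_mem_deg {d : ℕ} {f : Poly n} (hf : f.IsHomogeneous d) {i j : ℕ}
    (hij : i ≤ j) (x : Brieskorn f) (hx : x ∈ Brieskorn.deg f (i * d)) :
    (Brieskorn.mulF f ^ (j - i)) x ∈ Brieskorn.deg f (j * d) := by
  induction j, hij using Nat.le_induction with
  | base => simpa using hx
  | succ j hij ih =>
    rw [Nat.sub_add_comm hij, pow_succ', add_mul, one_mul]
    exact Brieskorn.mulF_mem_deg hf ih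

/-- The transition maps `H_{f,id} → H_{f,jd}`, `i ≤ j`, given by multiplication by `f^{j-i}`; from `k` to
`k + 1` it is the multiplication by `f`. -/
def Brieskorn.transition {d : ℕ} {f : Poly n} (hf : f.IsHomogeneous d) (i j : ℕ) (hij : i ≤ j) :
    Brieskorn.deg f (i * d) →ₗ[ℂ] Brieskorn.deg f (j * d) :=
  (Brieskorn.mulF f ^ (j - i)).restrict (Brieskorn.mulF_pow_mem_deg hf hij)

lemma Brieskorn.transition_succ {d : ℕ} {f : Poly n} (hf : f.IsHomogeneous d) (k : ℕ)
    (x : Brieskorn.deg f (k * d)) :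
    (Brieskorn.transition hf k (k + 1) k.le_succ x : Brieskorn f) = Brieskorn.mulF f x := by
  simp [Brieskorn.transition]

/-- The direct limit of the `H_{f,kd}` over `k : ℕ`, with transition maps multiplication by `f`. -/
abbrev Brieskorn.Limit {d : ℕ} {f : Poly n} (hf : f.IsHomogeneous d) : Type :=
  Module.DirectLimit (fun k : ℕ => Brieskorn.deg f (k * d)) (Brieskorn.transition hf)

end Affine

end DeRham

end

open DeRham

/-!
Write `L = ℂ[x][f⁻¹]`, `θ = df/f`, `ι = ι_ξ`, and let `A ⊆ L` be the ring of elements of degree zero, the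
ring of functions of the affine variety `U`.

As `ι θ = ξ(f)/f = 1`, one has `ι (θ ∧ ω) + θ ∧ ι ω = ω` for every form `ω` (`eulerContraction_dlog_mul`).
So the terms `Ω^j[f⁻¹]_0^{(ξ)}` are the horizontal forms (`ι ω = 0`) of degree zero (`mem_xiForms_iff`),
and `θ ∧` is injective on them.

*First isomorphism.* Pullback identifies the `j`-forms of `A` with the horizontal `j`-forms of degree zero,
so that `ω ↦ θ ∧ π^*ω` is even an isomorphism of complexes. The argument rests on the functions
`uᵢ = ∂ᵢf / (d f)` of degree `-1`, for which `∑ xᵢ uᵢ = 1` and `∑ uᵢ dxᵢ = θ / d`.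
* Surjectivity (`exists_formsMap_eq_of_mem_xiForms`): the horizontal projection `ω ↦ ι (θ ∧ ω)` is
  multiplicative and sends `dxⱼ` to `∑ᵢ xᵢ d(xⱼ uᵢ)`, where `xⱼ uᵢ ∈ A`.
* Injectivity (`formsMap_injective`): for `tᵢ = xᵢ uᵢ ∈ A`, setting `xᵢ = 1` defines a map `L → A[tᵢ⁻¹]`
  that restricts to the localization map on `A`. A form of `A` that vanishes on `L` is thus killed by
  a power of each `tᵢ`, and `∑ tᵢ = 1`.

*Second isomorphism.* In degree `n` the complex consists of all `(n+1)`-forms of degree zero, that is, of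
the fractions `η / f^k` with `η` of degree `k d`; all of them are cocycles. The coboundaries are the
`θ ∧ dσ` with `σ` any `(n-1)`-form of degree zero (`mem_coboundaries_dlogXiForms_iff`). Since
`θ ∧ d(σ / f^k) = (df ∧ dσ) / f^{k+1}`, the class of `η / f^k` vanishes if and only if some
`f^N η` lies in `df ∧ dΩ^{n-1}`, which is what vanishing in the direct limit means
(`divPow_mem_coboundaries`, `exists_pow_smul_mem_brieskornRel`). One point needs care: in a homogeneous
relation `η = df ∧ dσ` the form `σ` can be taken homogeneous. This follows from the independence of the
eigenspaces of the pullback by `x ↦ 2x` (`exists_homogeneous_of_eq_dOf_mul`).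
-/

open scoped KaehlerDifferential

noncomputable section

namespace DeRham

/-! ### Pullback of algebraic differential forms -/

section PullbackOfForms

variable {k A B C : Type*} [CommRing k] [CommRing A] [Algebra k A] [CommRing B] [Algebra k B]
  [CommRing C] [Algebra k C]

/-- Induction along the generation of all forms by functions and exact one-forms. -/
@[elab_as_elim]
lemma forms_induction {P : Forms k A → Prop} (x : Forms k A)
    (algebraMap : ∀ a, P (algebraMap A (Forms k A) a))
    (add : ∀ x y, P x → P y → P (x + y))
    (smul_dOf_mul : ∀ (a b : A) x, P x → P (a • (dOf k A b * x))) : P x := by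
  induction x using CliffordAlgebra.left_induction with
  | algebraMap r => exact algebraMap r
  | add x y hx hy => exact add x y hx hy
  | ι_mul x m hx =>
    change P (ExteriorAlgebra.ι A m * x)
    induction m using kaehler_induction with
    | zero => simpa using algebraMap 0
    | add y z hy hz => rw [map_add, add_mul]; exact add _ _ hy hz
    | smul a b => rw [map_smul, smul_mul_assoc]; exact smul_dOf_mul a b x hx

/-- Induction along the generation of the forms of each degree `j`. -/
lemma exteriorPower_induction {P : ℕ → Forms k A → Prop}
    (algebraMap : ∀ a, P 0 (algebraMap A (Forms k A) a))
    (zero : ∀ j, P j 0)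
    (add : ∀ j x y, P j x → P j y → P j (x + y))
    (smul_dOf_mul : ∀ j (a b : A) x, P j x → P (j + 1) (a • (dOf k A b * x)))
    {j : ℕ} {x : Forms k A} (hx : x ∈ ⋀[A]^j (Ω[A⁄k])) : P j x := by
  induction j generalizing x with
  | zero =>
    rw [ExteriorAlgebra.exteriorPower, pow_zero] at hx
    obtain ⟨a, rfl⟩ := Submodule.mem_one.mp hx
    exact algebraMap a
  | succ j ih =>
    rw [ExteriorAlgebra.exteriorPower, pow_succ'] at hx
    induction hx using Submodule.mul_induction_on' with
    | mem_mul_mem m hm y hy =>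
      obtain ⟨m, rfl⟩ := hm
      induction m using kaehler_induction with
      | zero => simpa using zero (j + 1)
      | add m m' h h' => rw [map_add, add_mul]; exact add _ _ _ h h'
      | smul a b => rw [map_smul, smul_mul_assoc]; exact smul_dOf_mul j a b y (ih hy)
    | add x _ y _ hx hy => exact add _ x y hx hy

lemma dOf_mul_mem_exteriorPower {j : ℕ} (a : A) {x : Forms k A} (hx : x ∈ ⋀[A]^j (Ω[A⁄k])) :
    dOf k A a * x ∈ ⋀[A]^(j + 1) (Ω[A⁄k]) := by
  rw [ExteriorAlgebra.exteriorPower, pow_succ']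
  exact Submodule.mul_mem_mul ⟨_, rfl⟩ hx

lemma algebraMap_mem_exteriorPower (a : A) :
    algebraMap A (Forms k A) a ∈ ⋀[A]^0 (Ω[A⁄k]) := by
  rw [ExteriorAlgebra.exteriorPower, pow_zero]
  exact Submodule.mem_one.mpr ⟨a, rfl⟩

lemma dOf_sq (a : A) : dOf k A a * dOf k A a = 0 := ExteriorAlgebra.ι_sq_zero _

lemma dOf_anticomm (a b : A) : dOf k A a * dOf k A b = -(dOf k A b * dOf k A a) :=
  ι_anticomm _ _

lemma dOf_algebraMap (c : k) : dOf k A (algebraMap k A c) = 0 := by simp [dOf]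

lemma dOf_smul (c : k) (a : A) : dOf k A (c • a) = c • dOf k A a := by
  rw [Algebra.smul_def, dOf_mul, dOf_algebraMap, smul_zero, add_zero, algebraMap_smul]

lemma dOf_sum {ι : Type*} (s : Finset ι) (a : ι → A) :
    dOf k A (∑ i ∈ s, a i) = ∑ i ∈ s, dOf k A (a i) := by simp [dOf]

lemma formsMap_smul (φ : A →ₐ[k] B) (a : A) (x : Forms k A) :
    formsMap φ (a • x) = φ a • formsMap φ x := by
  rw [Algebra.smul_def, map_mul, formsMap_algebraMap, Algebra.smul_def]

lemma formsMap_formDeriv (φ : A →ₐ[k] B) (x : Forms k A) :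
    formsMap φ (formDeriv k A x) = formDeriv k B (formsMap φ x) := by
  induction x using forms_induction with
  | algebraMap a => rw [formDeriv_algebraMap, formsMap_dOf, formsMap_algebraMap,
      formDeriv_algebraMap]
  | add x y hx hy => simp only [map_add, hx, hy]
  | smul_dOf_mul a b x hx =>
    simp only [formDeriv_smul, formsMap_smul, map_add, map_mul, formsMap_dOf, formDeriv_dOf_mul,
      map_neg, hx]

lemma formsMap_comp (ψ : B →ₐ[k] C) (φ : A →ₐ[k] B) (x : Forms k A) :
    formsMap (ψ.comp φ) x = formsMap ψ (formsMap φ x) := by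
  induction x using forms_induction with
  | algebraMap a => simp only [formsMap_algebraMap, AlgHom.comp_apply]
  | add x y hx hy => simp only [map_add, hx, hy]
  | smul_dOf_mul a b x hx =>
    simp only [formsMap_smul, map_mul, formsMap_dOf, hx, AlgHom.comp_apply]

lemma formsMap_id (x : Forms k A) : formsMap (AlgHom.id k A) x = x := by
  induction x using forms_induction with
  | algebraMap a => simp only [formsMap_algebraMap, AlgHom.id_apply]
  | add x y hx hy => simp only [map_add, hx, hy]
  | smul_dOf_mul a b x hx =>
    simp only [formsMap_smul, map_mul, formsMap_dOf, hx, AlgHom.id_apply]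

lemma formsMap_mem_exteriorPower (φ : A →ₐ[k] B) {j : ℕ} {x : Forms k A}
    (hx : x ∈ ⋀[A]^j (Ω[A⁄k])) : formsMap φ x ∈ ⋀[B]^j (Ω[B⁄k]) := by
  refine exteriorPower_induction (P := fun j x => formsMap φ x ∈ ⋀[B]^j (Ω[B⁄k]))
    (fun a => ?_) (fun j => ?_) (fun j x y hx hy => ?_) (fun j a b x hx => ?_) hx
  · rw [formsMap_algebraMap]; exact algebraMap_mem_exteriorPower _
  · rw [map_zero]; exact zero_mem _
  · rw [map_add]; exact add_mem hx hy
  · rw [formsMap_smul, map_mul, formsMap_dOf]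
    have h := dOf_mul_mem_exteriorPower (φ b) hx
    exact Submodule.smul_mem (⋀[B]^(j + 1) (Ω[B⁄k])) (φ a) h

/-- A form on `A` that vanishes on the locus `s ≠ 0` is killed by a power of `s`. The reason is that the
forms of the localization `B` map back to `B ⊗ Forms k A`, by the base change property of Kähler
differentials. -/
lemma exists_pow_smul_eq_zero_of_formsMap_eq_zero [Algebra A B] [IsScalarTower k A B] (s : A)
    [IsLocalization.Away s B] {x : Forms k A}
    (hx : formsMap (IsScalarTower.toAlgHom k A B) x = 0) : ∃ N : ℕ, s ^ N • x = 0 := by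
  have : Algebra.FormallyEtale A B := .of_isLocalization (Submonoid.powers s)
  have hbc := KaehlerDifferential.isBaseChange_of_formallyEtale k A B
  let T : Ω[B⁄k] →ₗ[B] TensorProduct A B (Forms k A) :=
    hbc.lift ((TensorProduct.mk A B (Forms k A) 1).comp (ExteriorAlgebra.ι A))
  have hT (m : Ω[A⁄k]) : T (KaehlerDifferential.map k k A B m) = 1 ⊗ₜ ExteriorAlgebra.ι A m :=
    hbc.lift_eq _ m
  have hloc : IsLocalizedModule (Submonoid.powers s) (KaehlerDifferential.map k k A B) :=
    (isLocalizedModule_iff_isBaseChange (Submonoid.powers s) B _).mpr hbc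
  -- Up to a power of `s`, every one-form on `B` comes from `A`, where squares vanish.
  have hsq (m : Ω[B⁄k]) : T m * T m = 0 := by
    obtain ⟨⟨m', c⟩, hm⟩ := IsLocalizedModule.surj (Submonoid.powers s)
      (KaehlerDifferential.map k k A B) m
    have hc : IsUnit (algebraMap A B c) := IsLocalization.map_units B c
    have h1 : algebraMap A B c • T m = 1 ⊗ₜ ExteriorAlgebra.ι A m' := by
      rw [← hT, ← hm, ← map_smul]
      simp [Submonoid.smul_def]
    have h2 : (algebraMap A B c * algebraMap A B c) • (T m * T m) = 0 := by
      rw [← smul_mul_smul_comm, h1]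
      simp
    exact (hc.mul hc).smul_eq_zero.mp h2
  let R : Forms k B →ₐ[B] TensorProduct A B (Forms k A) := ExteriorAlgebra.lift B ⟨T, hsq⟩
  have hR (y : Forms k A) : R (formsMap (IsScalarTower.toAlgHom k A B) y) = 1 ⊗ₜ y := by
    induction y using forms_induction with
    | algebraMap a =>
      rw [formsMap_algebraMap, AlgHom.commutes, Algebra.algebraMap_eq_smul_one (A := Forms k A),
        ← TensorProduct.smul_tmul]
      simp [Algebra.algebraMap_eq_smul_one, Algebra.TensorProduct.one_def, TensorProduct.smul_tmul']
    | add x y hx hy => rw [map_add, map_add, hx, hy, TensorProduct.tmul_add]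
    | smul_dOf_mul a b x hx =>
      have h1 : R (dOf k B (algebraMap A B b)) = 1 ⊗ₜ dOf k A b := by
        refine (ExteriorAlgebra.lift_ι_apply _ _ _ _).trans ?_
        rw [← KaehlerDifferential.map_D k k A B, hT]; rfl
      rw [formsMap_smul, map_mul, formsMap_dOf, map_smul, map_mul, hx,
        IsScalarTower.coe_toAlgHom', h1, algebraMap_smul, Algebra.TensorProduct.tmul_mul_tmul,
        mul_one, TensorProduct.tmul_smul]
  have h0 : (TensorProduct.mk A B (Forms k A) 1) x = 0 := by
    rw [TensorProduct.mk_apply, ← hR, hx, map_zero]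
  obtain ⟨⟨_, N, rfl⟩, hN⟩ := (IsLocalizedModule.eq_zero_iff (Submonoid.powers s)
    (TensorProduct.mk A B (Forms k A) 1)).mp h0
  exact ⟨N, hN⟩

end PullbackOfForms

/-! ### Cohomology and direct limits -/

section Cohomology

variable {k E F : Type*} [CommRing k] [AddCommGroup E] [Module k E] [AddCommGroup F] [Module k F]

lemma coboundaries_eq_map (C : ℕ → Submodule k E) (δ : E →ₗ[k] E) {j : ℕ} (hj : 0 < j) :
    coboundaries C δ j = (C (j - 1)).map δ := by
  cases j with
  | zero => exact absurd hj (lt_irrefl 0)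
  | succ j => rfl

/-- In degree `n` every form of degree zero is a cocycle of `(df/f) ∧ Ω^•[f⁻¹]_0^{(ξ)}`: wedging with `df/f`
gives zero, so `ω = (df/f) ∧ ι_ξ ω`, and `dω = 0`. -/
lemma cohomology_mk_eq_zero_iff {C : ℕ → Submodule k E} {δ : E →ₗ[k] E} {j : ℕ} (x : cocycles C δ j) :
    Cohomology.mk C δ j x = 0 ↔ (x : E) ∈ coboundaries C δ j :=
  Submodule.Quotient.mk_eq_zero _

lemma cohomology_mk_surjective (C : ℕ → Submodule k E) (δ : E →ₗ[k] E) (j : ℕ) (z : Cohomology C δ j) :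
    ∃ x hx, Cohomology.mk C δ j ⟨x, hx⟩ = z := by
  obtain ⟨⟨x, hx⟩, rfl⟩ := Submodule.mkQ_surjective _ z
  exact ⟨x, hx, rfl⟩

/-- An isomorphism of complexes induces an isomorphism in cohomology. The map `T` of ambient modules is
only required to be injective on a submodule `S` that contains the terms of the complex `C`. -/
lemma exists_cohomology_equiv {C : ℕ → Submodule k E} {δ : E →ₗ[k] E} {D : ℕ → Submodule k F}
    {δ' : F →ₗ[k] F} (T : E →ₗ[k] F) (S : Submodule k E) (hS : ∀ j, C j ≤ S)
    (hδ : ∀ x ∈ S, δ x ∈ S) (hinj : ∀ x ∈ S, T x = 0 → x = 0) (hmap : ∀ j, (C j).map T = D j)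
    (hcomm : ∀ x, T (δ x) = δ' (T x)) (j : ℕ) :
    ∃ e : Cohomology C δ j ≃ₗ[k] Cohomology D δ' j, ∀ x : cocycles C δ j,
      ∃ h : T x ∈ cocycles D δ' j, e (Cohomology.mk C δ j x) = Cohomology.mk D δ' j ⟨T x, h⟩ := by
  have hmem (x : E) (hx : x ∈ cocycles C δ j) : T x ∈ cocycles D δ' j := by
    refine ⟨hmap j ▸ Submodule.mem_map_of_mem hx.1, ?_⟩
    exact (hcomm x).symm.trans ((congrArg T (LinearMap.mem_ker.mp hx.2)).trans (map_zero T))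
  have hcob : (coboundaries C δ j).map T = coboundaries D δ' j := by
    cases j with
    | zero => exact Submodule.map_bot T
    | succ j =>
      change ((C j).map δ).map T = (D j).map δ'
      rw [← hmap j, ← Submodule.map_comp, ← Submodule.map_comp]
      congr 1
      exact LinearMap.ext hcomm
  have hcobS : coboundaries C δ j ≤ S := by
    cases j with
    | zero => exact bot_le
    | succ j =>
      rintro _ ⟨x, hx, rfl⟩
      exact hδ x (hS j hx)
  let Q : cocycles C δ j →ₗ[k] Cohomology D δ' j :=
    ((coboundaries D δ' j).submoduleOf (cocycles D δ' j)).mkQ ∘ₗ T.restrict hmem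
  have hker : (coboundaries C δ j).submoduleOf (cocycles C δ j) = LinearMap.ker Q := by
    ext x
    rw [LinearMap.mem_ker]
    change (x : E) ∈ coboundaries C δ j ↔ Submodule.Quotient.mk _ = 0
    rw [Submodule.Quotient.mk_eq_zero]
    change (x : E) ∈ coboundaries C δ j ↔ T x ∈ coboundaries D δ' j
    rw [← hcob]
    refine ⟨Submodule.mem_map_of_mem, ?_⟩
    rintro ⟨y, hy, hxy⟩
    have h0 : y - x = 0 := hinj _ (sub_mem (hcobS hy) (hS j x.2.1))
      (by rw [map_sub, hxy, sub_self])
    rwa [← sub_eq_zero.mp h0]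
  have hsurj : Function.Surjective Q := by
    intro z
    obtain ⟨⟨y, hy⟩, rfl⟩ := Submodule.mkQ_surjective _ z
    obtain ⟨x, hx, rfl⟩ : y ∈ (C j).map T := hmap j ▸ hy.1
    refine ⟨⟨x, hx, hinj _ (hδ x (hS j hx)) ?_⟩, rfl⟩
    rw [hcomm]
    exact hy.2
  exact ⟨(Submodule.quotEquivOfEq _ _ hker).trans (Q.quotKerEquivOfSurjective hsurj),
    fun x => ⟨hmem x x.2, rfl⟩⟩

/-- A linear map that vanishes on the kernel of a surjection factors through it. -/
lemma exists_factorization {K M N P : Type*} [Ring K] [AddCommGroup M] [Module K M]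
    [AddCommGroup N] [Module K N] [AddCommGroup P] [Module K P] (p : M →ₗ[K] N)
    (hp : Function.Surjective p) (q : M →ₗ[K] P) (h : LinearMap.ker p ≤ LinearMap.ker q) :
    ∃ r : N →ₗ[K] P, ∀ x, r (p x) = q x := by
  refine ⟨(LinearMap.ker p).liftQ q h ∘ₗ (p.quotKerEquivOfSurjective hp).symm.toLinearMap,
    fun x => ?_⟩
  have h1 : (p.quotKerEquivOfSurjective hp).symm (p x) = (LinearMap.ker p).mkQ x := by
    rw [LinearEquiv.symm_apply_eq]
    rfl
  change (LinearMap.ker p).liftQ q h ((p.quotKerEquivOfSurjective hp).symm (p x)) = _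
  rw [h1]
  rfl

/-- A module is the direct limit of a directed system as soon as it receives compatible maps that are
jointly surjective and whose kernels consist of elements that vanish further on in the system. -/
lemma exists_equiv_directLimit {K ι : Type*} [Ring K] [Preorder ι] [DecidableEq ι] [Nonempty ι]
    [IsDirectedOrder ι] {G : ι → Type*} [∀ i, AddCommGroup (G i)] [∀ i, Module K (G i)]
    {T : ∀ i j, i ≤ j → G i →ₗ[K] G j} {P : Type*} [AddCommGroup P] [Module K P]
    (F : ∀ i, G i →ₗ[K] P) (hF : ∀ i j hij x, F j (T i j hij x) = F i x)
    (hker : ∀ i x, F i x = 0 → ∃ j hij, T i j hij x = 0) (hsurj : ∀ y, ∃ i x, F i x = y) :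
    ∃ e : P ≃ₗ[K] Module.DirectLimit G T, ∀ i x, e (F i x) = Module.DirectLimit.of K ι G T i x := by
  let L : Module.DirectLimit G T →ₗ[K] P := Module.DirectLimit.lift K ι G T F hF
  have hL (i x) : L (Module.DirectLimit.of K ι G T i x) = F i x :=
    Module.DirectLimit.lift_of F hF x
  have hinj : Function.Injective L := by
    rw [injective_iff_map_eq_zero]
    intro z hz
    obtain ⟨i, x, rfl⟩ := Module.DirectLimit.exists_of z
    obtain ⟨j, hij, h⟩ := hker i x ((hL i x).symm.trans hz)
    rw [← Module.DirectLimit.of_f (hij := hij), h, map_zero]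
  have hsurj' : Function.Surjective L := fun y => by
    obtain ⟨i, x, rfl⟩ := hsurj y
    exact ⟨_, hL i x⟩
  refine ⟨(LinearEquiv.ofBijective L ⟨hinj, hsurj'⟩).symm, fun i x => ?_⟩
  rw [LinearEquiv.symm_apply_eq]
  exact (hL i x).symm

end Cohomology

/-! ### The graded pieces of the forms on the complement of the cone -/

section LocalizedForms

variable {n d : ℕ} {f : Poly n}

/-- The coordinate function `xᵢ` on `{f ≠ 0}`. -/
abbrev locX (f : Poly n) (i : Fin (n + 1)) : PolyLoc f :=
  algebraMap (Poly n) (PolyLoc f) (MvPolynomial.X i)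

/-- `y` is homogeneous of degree `k` in the `ℤ`-graded ring `ℂ[x][f⁻¹]`, that is, a fraction `g / f^m`
with `g` homogeneous and `deg g - m d = k`. The zero element is homogeneous of every degree. -/
def IsLocHomogeneous (f : Poly n) (d : ℕ) (y : PolyLoc f) (k : ℤ) : Prop :=
  ∃ (e m : ℕ) (g : Poly n), g.IsHomogeneous e ∧ (e : ℤ) = k + m * d ∧
    y = algebraMap (Poly n) (PolyLoc f) g * fInv f ^ m

lemma algebraMap_mul_fInv (f : Poly n) : algebraMap (Poly n) (PolyLoc f) f * fInv f = 1 :=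
  IsLocalization.Away.mul_invSelf f

lemma algebraMap_pow_mul_fInv_pow (f : Poly n) (N : ℕ) :
    algebraMap (Poly n) (PolyLoc f) f ^ N * fInv f ^ N = 1 := by
  rw [← mul_pow, algebraMap_mul_fInv, one_pow]

namespace IsLocHomogeneous

lemma of_poly {g : Poly n} {e : ℕ} (hg : g.IsHomogeneous e) :
    IsLocHomogeneous f d (algebraMap (Poly n) (PolyLoc f) g) e :=
  ⟨e, 0, g, hg, by simp, by simp⟩

lemma var (i : Fin (n + 1)) : IsLocHomogeneous f d (locX f i) 1 := by
  simpa using of_poly (f := f) (d := d) (MvPolynomial.isHomogeneous_X ℂ i)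

lemma mul {y z : PolyLoc f} {k l : ℤ} (hy : IsLocHomogeneous f d y k)
    (hz : IsLocHomogeneous f d z l) : IsLocHomogeneous f d (y * z) (k + l) := by
  obtain ⟨e, m, g, hg, he, rfl⟩ := hy
  obtain ⟨e', m', g', hg', he', rfl⟩ := hz
  refine ⟨e + e', m + m', g * g', hg.mul hg', by push_cast; rw [he, he']; ring, ?_⟩
  rw [map_mul, pow_add]; ring

lemma inv : IsLocHomogeneous f d (fInv f) (-d) :=
  ⟨0, 1, 1, MvPolynomial.isHomogeneous_one _ _, by simp, by simp⟩

lemma one : IsLocHomogeneous f d 1 0 := by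
  simpa using of_poly (f := f) (d := d) (MvPolynomial.isHomogeneous_one (Fin (n + 1)) ℂ)

lemma pow {y : PolyLoc f} {k : ℤ} (hy : IsLocHomogeneous f d y k) (m : ℕ) :
    IsLocHomogeneous f d (y ^ m) (m * k) := by
  induction m with
  | zero => simpa using one
  | succ m ih => rw [pow_succ]; convert ih.mul hy using 1; push_cast; ring

lemma zero (hd : 0 < d) (k : ℤ) : IsLocHomogeneous f d 0 k := by
  refine ⟨(k + k.natAbs * d).toNat, k.natAbs, 0, MvPolynomial.isHomogeneous_zero _ _ _, ?_, by simp⟩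
  refine Int.toNat_of_nonneg ?_
  have h : (k.natAbs : ℤ) * 1 ≤ k.natAbs * d := by gcongr; exact_mod_cast hd
  omega

lemma smul (c : ℂ) {y : PolyLoc f} {k : ℤ} (hy : IsLocHomogeneous f d y k) :
    IsLocHomogeneous f d (c • y) k := by
  obtain ⟨e, m, g, hg, he, rfl⟩ := hy
  refine ⟨e, m, c • g, (MvPolynomial.homogeneousSubmodule _ _ e).smul_mem c hg, he, ?_⟩
  rw [← smul_mul_assoc, Algebra.smul_def, Algebra.smul_def, map_mul,
    ← IsScalarTower.algebraMap_apply]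

lemma add (hf : f.IsHomogeneous d) {y z : PolyLoc f} {k : ℤ} (hy : IsLocHomogeneous f d y k)
    (hz : IsLocHomogeneous f d z k) : IsLocHomogeneous f d (y + z) k := by
  obtain ⟨e, m, g, hg, he, rfl⟩ := hy
  obtain ⟨e', m', g', hg', he', rfl⟩ := hz
  have h : e' + d * m = e + d * m' := by zify; rw [he, he']; ring
  refine ⟨e + d * m', m + m', g * f ^ m' + g' * f ^ m,
    (hg.mul (hf.pow m')).add (h ▸ hg'.mul (hf.pow m)), by push_cast; rw [he]; ring, ?_⟩
  simp only [map_add, map_mul, map_pow, pow_add]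
  linear_combination
    (-algebraMap (Poly n) (PolyLoc f) g * fInv f ^ m) * algebraMap_pow_mul_fInv_pow f m'
    - (algebraMap (Poly n) (PolyLoc f) g' * fInv f ^ m') * algebraMap_pow_mul_fInv_pow f m

lemma pderiv (hd : 0 < d) {g : Poly n} {e : ℕ} (hg : g.IsHomogeneous e) (i : Fin (n + 1)) :
    IsLocHomogeneous f d (algebraMap (Poly n) (PolyLoc f) (MvPolynomial.pderiv i g)) (e - 1) := by
  cases e with
  | zero =>
    rw [MvPolynomial.totalDegree_eq_zero_iff_eq_C.mp (Nat.le_zero.mp hg.totalDegree_le)]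
    simpa using zero hd _
  | succ e => simpa using of_poly (f := f) (d := d) (hg.pderiv (i := i))

end IsLocHomogeneous

lemma dOf_fInv (f : Poly n) : dOf ℂ (PolyLoc f) (fInv f) =
    -(fInv f ^ 2 • dOf ℂ (PolyLoc f) (algebraMap (Poly n) (PolyLoc f) f)) := by
  rw [dOf, Derivation.leibniz_of_mul_eq_one _ ((mul_comm _ _).trans (algebraMap_mul_fInv f)),
    map_smul, neg_smul]
  rfl

lemma dOf_algebraMap_poly (g : Poly n) : dOf ℂ (PolyLoc f) (algebraMap (Poly n) (PolyLoc f) g) =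
    ∑ i, algebraMap (Poly n) (PolyLoc f) (MvPolynomial.pderiv i g) •
      dOf ℂ (PolyLoc f) (locX f i) := by
  have h := (KaehlerDifferential.mvPolynomialBasis ℂ (Fin (n + 1))).sum_repr
    (KaehlerDifferential.D ℂ (Poly n) g)
  simp only [KaehlerDifferential.mvPolynomialBasis_repr_apply,
    KaehlerDifferential.mvPolynomialBasis_apply] at h
  have h1 : dOf ℂ (Poly n) g = ∑ i, MvPolynomial.pderiv i g • dOf ℂ (Poly n) (.X i) := by
    rw [dOf, ← h, map_sum]
    exact Finset.sum_congr rfl fun i _ => map_smul _ _ _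
  have h2 := congrArg (formsMap (IsScalarTower.toAlgHom ℂ (Poly n) (PolyLoc f))) h1
  simp only [map_sum, formsMap_smul, formsMap_dOf] at h2
  exact h2

/-- The partial derivatives of a homogeneous element of degree `k` are homogeneous of degree
`k - 1`. -/
lemma IsLocHomogeneous.exists_dOf_eq_sum (hd : 0 < d) (hf : f.IsHomogeneous d) {y : PolyLoc f}
    {k : ℤ} (hy : IsLocHomogeneous f d y k) : ∃ c : Fin (n + 1) → PolyLoc f,
      (∀ i, IsLocHomogeneous f d (c i) (k - 1)) ∧ dOf ℂ (PolyLoc f) y =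
        ∑ i, c i • dOf ℂ (PolyLoc f) (locX f i) := by
  obtain ⟨e, m, g, hg, he, rfl⟩ := hy
  obtain rfl : k = e + m * (-d) := by rw [he]; ring
  clear he
  induction m with
  | zero =>
    exact ⟨fun i => _, fun i => by simpa using IsLocHomogeneous.pderiv hd hg i,
      by simpa using dOf_algebraMap_poly g⟩
  | succ m ih =>
    obtain ⟨c, hc, h⟩ := ih
    refine ⟨fun i => fInv f * c i + (-1 : ℂ) •
      (algebraMap (Poly n) (PolyLoc f) g * fInv f ^ m * fInv f ^ 2 *
        algebraMap (Poly n) (PolyLoc f) (MvPolynomial.pderiv i f)), fun i => ?_, ?_⟩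
    · refine IsLocHomogeneous.add hf ?_ (.smul _ ?_)
      · convert IsLocHomogeneous.inv.mul (hc i) using 1; push_cast; ring
      · convert (((IsLocHomogeneous.of_poly hg).mul (IsLocHomogeneous.inv.pow m)).mul
          (IsLocHomogeneous.inv.pow 2)).mul (IsLocHomogeneous.pderiv hd hf i) using 1
        push_cast; ring
    · rw [pow_succ, ← mul_assoc, dOf_mul, h, dOf_fInv, dOf_algebraMap_poly]
      simp only [Finset.smul_sum, ← Finset.sum_neg_distrib, ← Finset.sum_add_distrib, add_smul,
        mul_smul, neg_smul, one_smul, smul_neg]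
      refine Finset.sum_congr rfl fun i _ => ?_
      exact add_comm _ _

lemma dxMonomial_cons {j : ℕ} (i : Fin (n + 1)) (s : Fin j → Fin (n + 1)) :
    dxMonomial (PolyLoc f) (Fin.cons i s : Fin (j + 1) → Fin (n + 1)) =
      dOf ℂ (PolyLoc f) (locX f i) * dxMonomial (PolyLoc f) s := by
  rw [dxMonomial, ExteriorAlgebra.ιMulti_succ_apply]
  rfl

lemma dxMonomial_fin_zero (s : Fin 0 → Fin (n + 1)) : dxMonomial (PolyLoc f) s = 1 :=
  ExteriorAlgebra.ιMulti_zero_apply _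

lemma smul_dxMonomial_mem {y : PolyLoc f} {k K : ℤ} (hy : IsLocHomogeneous f d y k) {j : ℕ}
    (hK : k + j = K) (s : Fin j → Fin (n + 1)) :
    y • dxMonomial (PolyLoc f) s ∈ locFormsDeg f d j K := by
  obtain ⟨e, m, g, hg, he, rfl⟩ := hy
  exact Submodule.subset_span ⟨e, m, g, s, hg, by rw [he, ← hK]; ring, rfl⟩

@[elab_as_elim]
lemma locFormsDeg_induction {j : ℕ} {K : ℤ} {P : ∀ ω, ω ∈ locFormsDeg f d j K → Prop}
    (mem : ∀ (y : PolyLoc f) (s : Fin j → Fin (n + 1)) (hy : IsLocHomogeneous f d y (K - j)),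
      P (y • dxMonomial (PolyLoc f) s) (smul_dxMonomial_mem hy (by ring) s))
    (zero : P 0 (zero_mem _)) (add : ∀ x y hx hy, P x hx → P y hy → P (x + y) (add_mem hx hy))
    (smul : ∀ (c : ℂ) x hx, P x hx → P (c • x) (Submodule.smul_mem _ c hx))
    {ω : Forms ℂ (PolyLoc f)} (hω : ω ∈ locFormsDeg f d j K) : P ω hω := by
  induction hω using Submodule.span_induction with
  | mem x hx =>
    obtain ⟨e, m, g, s, hg, he, rfl⟩ := hx
    exact mem _ s ⟨e, m, g, hg, by rw [← sub_eq_zero] at he ⊢; rw [← he]; ring, rfl⟩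
  | zero => exact zero
  | add x y hx hy h h' => exact add x y hx hy h h'
  | smul c x hx h => exact smul c x hx h

lemma smul_mem_locFormsDeg {y : PolyLoc f} {k K K' : ℤ} (hy : IsLocHomogeneous f d y k) {j : ℕ}
    {ω : Forms ℂ (PolyLoc f)} (hω : ω ∈ locFormsDeg f d j K) (hK : k + K = K') :
    y • ω ∈ locFormsDeg f d j K' := by
  induction hω using locFormsDeg_induction with
  | mem z s hz =>
    rw [smul_smul]
    exact smul_dxMonomial_mem (hy.mul hz) (by rw [← hK]; ring) s
  | zero => rw [smul_zero]; exact zero_mem _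
  | add ω η _ _ hω hη => rw [smul_add]; exact add_mem hω hη
  | smul c ω _ hω => rw [smul_comm]; exact Submodule.smul_mem _ c hω

lemma dOf_locX_mul_mem {j : ℕ} {K : ℤ} {ω : Forms ℂ (PolyLoc f)} (hω : ω ∈ locFormsDeg f d j K)
    (i : Fin (n + 1)) : dOf ℂ (PolyLoc f) (locX f i) * ω ∈ locFormsDeg f d (j + 1) (K + 1) := by
  induction hω using locFormsDeg_induction with
  | mem z s hz =>
    rw [mul_smul_comm, ← dxMonomial_cons]
    exact smul_dxMonomial_mem hz (by push_cast; ring) _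
  | zero => rw [mul_zero]; exact zero_mem _
  | add ω η _ _ hω hη => rw [mul_add]; exact add_mem hω hη
  | smul c ω _ hω => rw [mul_smul_comm]; exact Submodule.smul_mem _ c hω

lemma dOf_mul_mem_locFormsDeg (hd : 0 < d) (hf : f.IsHomogeneous d) {y : PolyLoc f} {k K K' : ℤ}
    (hy : IsLocHomogeneous f d y k) {j : ℕ} {ω : Forms ℂ (PolyLoc f)}
    (hω : ω ∈ locFormsDeg f d j K) (hK : k + K = K') :
    dOf ℂ (PolyLoc f) y * ω ∈ locFormsDeg f d (j + 1) K' := by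
  obtain ⟨c, hc, h⟩ := hy.exists_dOf_eq_sum hd hf
  rw [h, Finset.sum_mul]
  refine sum_mem fun i _ => ?_
  rw [smul_mul_assoc]
  exact smul_mem_locFormsDeg (hc i) (dOf_locX_mul_mem hω i) (by rw [← hK]; ring)

lemma dlog_mul_mem_locFormsDeg (hd : 0 < d) (hf : f.IsHomogeneous d) {j : ℕ} {K : ℤ}
    {ω : Forms ℂ (PolyLoc f)} (hω : ω ∈ locFormsDeg f d j K) :
    dlog f * ω ∈ locFormsDeg f d (j + 1) K := by
  rw [dlog, smul_mul_assoc]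
  exact smul_mem_locFormsDeg .inv (dOf_mul_mem_locFormsDeg hd hf (.of_poly hf) hω rfl)
    (by ring)

/-- There are no forms of degree greater than `n + 1` in `n + 1` variables. -/
lemma dOf_mul_eq_zero_of_top (hd : 0 < d) (hf : f.IsHomogeneous d) {y : PolyLoc f} {k K : ℤ}
    (hy : IsLocHomogeneous f d y k) {ω : Forms ℂ (PolyLoc f)}
    (hω : ω ∈ locFormsDeg f d (n + 1) K) : dOf ℂ (PolyLoc f) y * ω = 0 := by
  obtain ⟨c, hc, h⟩ := hy.exists_dOf_eq_sum hd hf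
  rw [h, Finset.sum_mul]
  refine Finset.sum_eq_zero fun i _ => ?_
  rw [smul_mul_assoc]
  induction hω using locFormsDeg_induction with
  | mem z s hz =>
    have h0 : dxMonomial (PolyLoc f) (Fin.cons i s : Fin (n + 1 + 1) → Fin (n + 1)) = 0 := by
      refine ExteriorAlgebra.ιMulti_eq_zero_of_not_inj fun hinj => ?_
      have := Fintype.card_le_of_injective (Fin.cons i s : Fin (n + 1 + 1) → Fin (n + 1))
        fun a b hab => hinj (by simp only [hab])
      simp at this
    rw [mul_smul_comm, ← dxMonomial_cons, h0, smul_zero, smul_zero]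
  | zero => rw [mul_zero, smul_zero]
  | add ω η _ _ hω hη => rw [mul_add, smul_add, hω, hη, add_zero]
  | smul c ω _ hω => rw [mul_smul_comm, smul_comm, hω, smul_zero]

lemma dlog_mul_eq_zero_of_top (hd : 0 < d) (hf : f.IsHomogeneous d) {K : ℤ}
    {ω : Forms ℂ (PolyLoc f)} (hω : ω ∈ locFormsDeg f d (n + 1) K) : dlog f * ω = 0 := by
  rw [dlog, smul_mul_assoc, dOf_mul_eq_zero_of_top hd hf (.of_poly hf) hω, smul_zero]

lemma formDeriv_dxMonomial {j : ℕ} (s : Fin j → Fin (n + 1)) :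
    formDeriv ℂ (PolyLoc f) (dxMonomial (PolyLoc f) s) = 0 := by
  induction j with
  | zero =>
    rw [dxMonomial_fin_zero, ← map_one (algebraMap (PolyLoc f) (Forms ℂ (PolyLoc f))),
      formDeriv_algebraMap, ← map_one (algebraMap ℂ (PolyLoc f)), dOf_algebraMap]
  | succ j ih =>
    rw [← Fin.cons_self_tail s, dxMonomial_cons, formDeriv_dOf_mul, ih, mul_zero, neg_zero]

lemma formDeriv_eq_zero_of_top (hd : 0 < d) (hf : f.IsHomogeneous d) {K : ℤ}
    {ω : Forms ℂ (PolyLoc f)} (hω : ω ∈ locFormsDeg f d (n + 1) K) :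
    formDeriv ℂ (PolyLoc f) ω = 0 := by
  induction hω using locFormsDeg_induction with
  | mem z s hz =>
    have h := smul_dxMonomial_mem (f := f) (d := d) .one rfl s
    rw [one_smul] at h
    rw [formDeriv_smul, formDeriv_dxMonomial, smul_zero, add_zero,
      dOf_mul_eq_zero_of_top hd hf hz h]
  | zero => exact map_zero _
  | add ω η _ _ hω hη => rw [map_add, hω, hη, add_zero]
  | smul c ω _ hω => rw [map_smul, hω, smul_zero]

/-! ### Contraction with the Euler field -/

/-- The Euler field `ξ`, as a derivation of `ℂ[x][f⁻¹]`. -/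
def locEuler (f : Poly n) (d : ℕ) : Derivation ℂ (PolyLoc f) (PolyLoc f) :=
  (eulerFunctional f d).compDer (KaehlerDifferential.D ℂ (PolyLoc f))

lemma locEuler_algebraMap {g : Poly n} {k : ℕ} (hg : g.IsHomogeneous k) :
    locEuler f d (algebraMap (Poly n) (PolyLoc f) g) =
      ((k : ℂ) / d) • algebraMap (Poly n) (PolyLoc f) g := by
  refine (eulerFunctional_D f d g).trans ?_
  rw [euler_apply_of_isHomogeneous hg, Algebra.smul_def, Algebra.smul_def, map_mul,
    ← IsScalarTower.algebraMap_apply]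

lemma locEuler_self (hd : 0 < d) (hf : f.IsHomogeneous d) :
    locEuler f d (algebraMap (Poly n) (PolyLoc f) f) = algebraMap (Poly n) (PolyLoc f) f := by
  rw [locEuler_algebraMap hf, div_self (by exact_mod_cast hd.ne'), one_smul]

lemma IsLocHomogeneous.locEuler_eq (hd : 0 < d) (hf : f.IsHomogeneous d) {y : PolyLoc f} {k : ℤ}
    (hy : IsLocHomogeneous f d y k) : locEuler f d y = ((k : ℂ) / d) • y := by
  obtain ⟨e, m, g, hg, he, rfl⟩ := hy
  obtain rfl : k = e + m * (-d) := by rw [he]; ring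
  clear he
  have hd' : (d : ℂ) ≠ 0 := by exact_mod_cast hd.ne'
  induction m with
  | zero => simpa using locEuler_algebraMap hg
  | succ m ih =>
    have h1 : locEuler f d (fInv f) = -fInv f := by
      rw [Derivation.leibniz_of_mul_eq_one _ ((mul_comm _ _).trans (algebraMap_mul_fInv f)),
        locEuler_self hd hf, smul_eq_mul]
      linear_combination (-fInv f) * algebraMap_mul_fInv f
    rw [pow_succ, ← mul_assoc, Derivation.leibniz, h1, ih, smul_neg, smul_eq_mul, smul_eq_mul,
      mul_smul_comm, mul_comm (fInv f), ← sub_eq_neg_add]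
    conv_lhs => rw [← one_smul ℂ (algebraMap (Poly n) (PolyLoc f) g * fInv f ^ m * fInv f)]
    rw [smul_smul, mul_one, ← sub_smul]
    congr 1
    push_cast
    field_simp
    ring

lemma eulerContraction_smul (y : PolyLoc f) (ω : Forms ℂ (PolyLoc f)) :
    eulerContraction f d (y • ω) = y • eulerContraction f d ω :=
  map_smul (CliffordAlgebra.contractLeft (Q := (0 : QuadraticForm (PolyLoc f) (Ω[PolyLoc f⁄ℂ])))
    (eulerFunctional f d)) y ω

lemma eulerContraction_dOf_mul (y : PolyLoc f) (ω : Forms ℂ (PolyLoc f)) :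
    eulerContraction f d (dOf ℂ (PolyLoc f) y * ω) =
      locEuler f d y • ω - dOf ℂ (PolyLoc f) y * eulerContraction f d ω :=
  CliffordAlgebra.contractLeft_ι_mul _ _ _

lemma eulerContraction_algebraMap (y : PolyLoc f) :
    eulerContraction f d (algebraMap (PolyLoc f) (Forms ℂ (PolyLoc f)) y) = 0 :=
  CliffordAlgebra.contractLeft_algebraMap _ _ _

lemma eulerContraction_eulerContraction (ω : Forms ℂ (PolyLoc f)) :
    eulerContraction f d (eulerContraction f d ω) = 0 :=
  CliffordAlgebra.contractLeft_contractLeft _ _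

lemma eulerContraction_one : eulerContraction f d (1 : Forms ℂ (PolyLoc f)) = 0 :=
  CliffordAlgebra.contractLeft_one _ _

/-- As `ι_ξ (df/f) = 1`, wedging with `df/f` is a contracting homotopy for `ι_ξ`. -/
lemma eulerContraction_dlog_mul (hd : 0 < d) (hf : f.IsHomogeneous d) (ω : Forms ℂ (PolyLoc f)) :
    eulerContraction f d (dlog f * ω) = ω - dlog f * eulerContraction f d ω := by
  rw [dlog, smul_mul_assoc, eulerContraction_smul, eulerContraction_dOf_mul, locEuler_self hd hf,
    smul_sub, smul_smul, mul_comm, algebraMap_mul_fInv, one_smul, smul_mul_assoc]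

lemma dlog_mul_dlog_mul (ω : Forms ℂ (PolyLoc f)) : dlog f * (dlog f * ω) = 0 := by
  rw [← mul_assoc, dlog, smul_mul_smul_comm, dOf_sq, smul_zero, zero_mul]

lemma formDeriv_dlog_mul (ω : Forms ℂ (PolyLoc f)) :
    formDeriv ℂ (PolyLoc f) (dlog f * ω) = -(dlog f * formDeriv ℂ (PolyLoc f) ω) := by
  rw [dlog, smul_mul_assoc, formDeriv_smul, dOf_fInv, formDeriv_dOf_mul, neg_mul, smul_mul_assoc,
    ← mul_assoc, dOf_sq, zero_mul, smul_zero, neg_zero, zero_add, smul_neg, smul_mul_assoc]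

lemma eulerContraction_dxMonomial_mem (hd : 0 < d) (hf : f.IsHomogeneous d) {j : ℕ}
    (s : Fin (j + 1) → Fin (n + 1)) :
    eulerContraction f d (dxMonomial (PolyLoc f) s) ∈ locFormsDeg f d j (j + 1) := by
  induction j with
  | zero =>
    rw [← Fin.cons_self_tail s, dxMonomial_cons, eulerContraction_dOf_mul,
      (IsLocHomogeneous.var _).locEuler_eq hd hf, dxMonomial_fin_zero, eulerContraction_one,
      mul_zero, sub_zero, ← dxMonomial_fin_zero (f := f) Fin.elim0]
    exact smul_dxMonomial_mem ((IsLocHomogeneous.var _).smul _) (by simp) _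
  | succ j ih =>
    rw [← Fin.cons_self_tail s, dxMonomial_cons, eulerContraction_dOf_mul,
      (IsLocHomogeneous.var _).locEuler_eq hd hf]
    refine sub_mem (smul_dxMonomial_mem ((IsLocHomogeneous.var _).smul _) (by ring) _) ?_
    have h := dOf_locX_mul_mem (ih (Fin.tail s)) (s 0)
    exact_mod_cast h

lemma eulerContraction_mem_locFormsDeg (hd : 0 < d) (hf : f.IsHomogeneous d) {j : ℕ} {K : ℤ}
    {ω : Forms ℂ (PolyLoc f)} (hω : ω ∈ locFormsDeg f d (j + 1) K) :
    eulerContraction f d ω ∈ locFormsDeg f d j K := by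
  induction hω using locFormsDeg_induction with
  | mem z s hz =>
    rw [eulerContraction_smul]
    exact smul_mem_locFormsDeg hz (eulerContraction_dxMonomial_mem hd hf s) (by push_cast; ring)
  | zero => rw [map_zero]; exact zero_mem _
  | add ω η _ _ hω hη => rw [map_add]; exact add_mem hω hη
  | smul c ω _ hω => rw [map_smul]; exact Submodule.smul_mem _ c hω

/-- The image of `ι_ξ` in degree zero is its kernel. -/
lemma mem_xiForms_iff (hd : 0 < d) (hf : f.IsHomogeneous d) {j : ℕ} {ω : Forms ℂ (PolyLoc f)} :
    ω ∈ xiForms f d j ↔ ω ∈ locFormsDeg f d j 0 ∧ eulerContraction f d ω = 0 := by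
  constructor
  · rintro ⟨η, hη, rfl⟩
    exact ⟨eulerContraction_mem_locFormsDeg hd hf hη, eulerContraction_eulerContraction η⟩
  · rintro ⟨h1, h2⟩
    refine ⟨dlog f * ω, dlog_mul_mem_locFormsDeg hd hf h1, ?_⟩
    rw [eulerContraction_dlog_mul hd hf, h2, mul_zero, sub_zero]

end LocalizedForms

/-! ### Descent of horizontal forms of degree zero -/

section Descent

variable {n d : ℕ} {f : Poly n}

/-- The functions `uᵢ = (∂ᵢ f) / (d f)`, of degree `-1`. By Euler's identity `∑ xᵢ uᵢ = 1`, and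
`∑ uᵢ dxᵢ = (1/d) df/f`. -/
def eulerDual (f : Poly n) (d : ℕ) (i : Fin (n + 1)) : PolyLoc f :=
  (d : ℂ)⁻¹ • (algebraMap (Poly n) (PolyLoc f) (MvPolynomial.pderiv i f) * fInv f)

lemma isLocHomogeneous_eulerDual (hd : 0 < d) (hf : f.IsHomogeneous d) (i : Fin (n + 1)) :
    IsLocHomogeneous f d (eulerDual f d i) (-1) := by
  refine .smul _ ?_
  convert (IsLocHomogeneous.pderiv hd hf i).mul .inv using 1
  ring

lemma sum_locX_mul_eulerDual (hd : 0 < d) (hf : f.IsHomogeneous d) :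
    ∑ i, locX f i * eulerDual f d i = 1 := by
  have hd' : (d : ℂ) ≠ 0 := by exact_mod_cast hd.ne'
  have h := congrArg (algebraMap (Poly n) (PolyLoc f)) hf.sum_X_mul_pderiv
  simp only [map_sum, map_mul, map_nsmul] at h
  simp only [eulerDual, mul_smul_comm, ← mul_assoc]
  rw [← Finset.smul_sum, ← Finset.sum_mul, h, smul_mul_assoc, algebraMap_mul_fInv,
    ← Nat.cast_smul_eq_nsmul ℂ, smul_smul, inv_mul_cancel₀ hd', one_smul]

lemma sum_eulerDual_smul_dOf (f : Poly n) (d : ℕ) :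
    ∑ i, eulerDual f d i • dOf ℂ (PolyLoc f) (locX f i) = (d : ℂ)⁻¹ • dlog f := by
  rw [dlog, dOf_algebraMap_poly, Finset.smul_sum, Finset.smul_sum]
  refine Finset.sum_congr rfl fun i _ => ?_
  rw [eulerDual, smul_assoc, mul_comm, mul_smul]

/-- The horizontal part of `dxⱼ` is a combination of differentials of functions of degree zero. -/
lemma sum_locX_smul_dOf (hd : 0 < d) (hf : f.IsHomogeneous d) (j : Fin (n + 1)) :
    ∑ i, locX f i • dOf ℂ (PolyLoc f) (locX f j * eulerDual f d i) =
      dOf ℂ (PolyLoc f) (locX f j) - ((d : ℂ)⁻¹ • locX f j) • dlog f := by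
  have h1 := congrArg (dOf ℂ (PolyLoc f)) (sum_locX_mul_eulerDual hd hf)
  rw [← map_one (algebraMap ℂ (PolyLoc f)), dOf_algebraMap, dOf_sum] at h1
  simp only [dOf_mul, Finset.sum_add_distrib, sum_eulerDual_smul_dOf] at h1
  have h2 : ∑ i, locX f i • locX f j • dOf ℂ (PolyLoc f) (eulerDual f d i) =
      locX f j • ∑ i, locX f i • dOf ℂ (PolyLoc f) (eulerDual f d i) := by
    rw [Finset.smul_sum]
    exact Finset.sum_congr rfl fun i _ => smul_comm _ _ _
  have h3 : ∑ i, locX f i • eulerDual f d i • dOf ℂ (PolyLoc f) (locX f j) =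
      dOf ℂ (PolyLoc f) (locX f j) := by
    simp only [smul_smul]
    rw [← Finset.sum_smul, sum_locX_mul_eulerDual hd hf, one_smul]
  simp only [dOf_mul, smul_add, Finset.sum_add_distrib]
  rw [h2, h3, eq_neg_of_add_eq_zero_left h1, smul_neg, smul_assoc, smul_comm (locX f j)]
  exact neg_add_eq_sub _ _

/-- The horizontal projection `ω ↦ ι_ξ (df/f ∧ ω)` is multiplicative: it is the algebra endomorphism that
sends `dy` to `dy - ξ(y) df/f`. -/
lemma eulerContraction_dlog_mul_dOf_mul (hd : 0 < d) (hf : f.IsHomogeneous d) (y : PolyLoc f)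
    (ω : Forms ℂ (PolyLoc f)) :
    eulerContraction f d (dlog f * (dOf ℂ (PolyLoc f) y * ω)) =
      (dOf ℂ (PolyLoc f) y - locEuler f d y • dlog f) * eulerContraction f d (dlog f * ω) := by
  have h : dOf ℂ (PolyLoc f) y * dlog f = -(dlog f * dOf ℂ (PolyLoc f) y) := by
    rw [dlog, mul_smul_comm, dOf_anticomm, smul_neg, smul_mul_assoc]
  simp only [eulerContraction_dlog_mul hd hf, eulerContraction_dOf_mul, mul_sub, sub_mul,
    mul_smul_comm, smul_mul_assoc, dlog_mul_dlog_mul, smul_zero, sub_zero]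
  rw [← mul_assoc (dOf ℂ (PolyLoc f) y), h, ← mul_assoc (dlog f), neg_mul]
  abel

variable {A : Type*} [CommRing A] [Algebra ℂ A] {φ : A →ₐ[ℂ] PolyLoc f}

lemma eulerContraction_formsMap (hd : 0 < d) (hf : f.IsHomogeneous d)
    (hφ : ∀ a, IsLocHomogeneous f d (φ a) 0) (x : Forms ℂ A) :
    eulerContraction f d (formsMap φ x) = 0 := by
  induction x using forms_induction with
  | algebraMap a => rw [formsMap_algebraMap, eulerContraction_algebraMap]
  | add x y hx hy => rw [map_add, map_add, hx, hy, add_zero]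
  | smul_dOf_mul a b x hx =>
    rw [formsMap_smul, map_mul, formsMap_dOf, eulerContraction_smul, eulerContraction_dOf_mul, hx,
      (hφ b).locEuler_eq hd hf]
    simp

lemma formsMap_mem_xiForms (hd : 0 < d) (hf : f.IsHomogeneous d)
    (hφ : ∀ a, IsLocHomogeneous f d (φ a) 0) {j : ℕ} {x : Forms ℂ A} (hx : x ∈ ⋀[A]^j (Ω[A⁄ℂ])) :
    formsMap φ x ∈ xiForms f d j := by
  rw [mem_xiForms_iff hd hf]
  refine ⟨?_, eulerContraction_formsMap hd hf hφ x⟩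
  refine exteriorPower_induction (P := fun j x => formsMap φ x ∈ locFormsDeg f d j 0)
    (fun a => ?_) (fun j => ?_) (fun j x y hx hy => ?_) (fun j a b x hx => ?_) hx
  · rw [formsMap_algebraMap, Algebra.algebraMap_eq_smul_one,
      ← dxMonomial_fin_zero (f := f) Fin.elim0]
    exact smul_dxMonomial_mem (hφ a) (by simp) _
  · rw [map_zero]; exact zero_mem _
  · rw [map_add]; exact add_mem hx hy
  · rw [formsMap_smul, map_mul, formsMap_dOf]
    exact smul_mem_locFormsDeg (hφ a) (dOf_mul_mem_locFormsDeg hd hf (hφ b) hx rfl) rfl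

/-- The horizontal part of `dx_{s 0} ∧ ⋯ ∧ dx_{s (j-1)}` descends once it is multiplied by a function `y` of
degree `-j`: each factor is replaced by `∑ᵢ xᵢ d(x_{s l} uᵢ)`, and `y` absorbs the `xᵢ`. -/
lemma exists_formsMap_eq_smul_contraction (hd : 0 < d) (hf : f.IsHomogeneous d)
    (hφ : ∀ y, IsLocHomogeneous f d y 0 → ∃ a, φ a = y) {j : ℕ} (s : Fin j → Fin (n + 1))
    {y : PolyLoc f} (hy : IsLocHomogeneous f d y (-j)) : ∃ x ∈ ⋀[A]^j (Ω[A⁄ℂ]),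
      formsMap φ x = y • eulerContraction f d (dlog f * dxMonomial (PolyLoc f) s) := by
  induction j generalizing y with
  | zero =>
    obtain ⟨a, rfl⟩ := hφ y (by simpa using hy)
    refine ⟨algebraMap A _ a, algebraMap_mem_exteriorPower a, ?_⟩
    rw [formsMap_algebraMap, dxMonomial_fin_zero, eulerContraction_dlog_mul hd hf,
      eulerContraction_one, mul_zero, sub_zero, Algebra.algebraMap_eq_smul_one]
  | succ j ih =>
    have h1 (i : Fin (n + 1)) : ∃ a, φ a = locX f (s 0) * eulerDual f d i :=
      hφ _ ((IsLocHomogeneous.var _).mul (isLocHomogeneous_eulerDual hd hf i))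
    choose a ha using h1
    have h2 (i : Fin (n + 1)) : IsLocHomogeneous f d (y * locX f i) (-j) := by
      convert hy.mul (.var i) using 1; push_cast; ring
    choose x hx hx' using fun i => ih (Fin.tail s) (h2 i)
    refine ⟨∑ i, dOf ℂ A (a i) * x i, sum_mem fun i _ => dOf_mul_mem_exteriorPower _ (hx i), ?_⟩
    have h3 : locEuler f d (locX f (s 0)) = (d : ℂ)⁻¹ • locX f (s 0) := by
      simpa using (IsLocHomogeneous.var (s 0)).locEuler_eq hd hf
    rw [← Fin.cons_self_tail s, dxMonomial_cons, eulerContraction_dlog_mul_dOf_mul hd hf, h3,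
      ← sum_locX_smul_dOf hd hf, Finset.sum_mul, Finset.smul_sum, map_sum]
    refine Finset.sum_congr rfl fun i _ => ?_
    rw [map_mul, formsMap_dOf, hx', ha, mul_smul_comm, smul_mul_assoc, smul_smul]

/-- Horizontal forms of degree zero descend to the ring of functions of degree zero. -/
lemma exists_formsMap_eq_of_mem_xiForms (hd : 0 < d) (hf : f.IsHomogeneous d)
    (hφ : ∀ y, IsLocHomogeneous f d y 0 → ∃ a, φ a = y) {j : ℕ} {ω : Forms ℂ (PolyLoc f)}
    (hω : ω ∈ xiForms f d j) : ∃ x ∈ ⋀[A]^j (Ω[A⁄ℂ]), formsMap φ x = ω := by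
  obtain ⟨h1, h2⟩ := (mem_xiForms_iff hd hf).mp hω
  have h3 : eulerContraction f d (dlog f * ω) = ω := by
    rw [eulerContraction_dlog_mul hd hf, h2, mul_zero, sub_zero]
  rw [← h3]
  clear h2 h3 hω
  induction h1 using locFormsDeg_induction with
  | mem y s hy =>
    rw [mul_smul_comm, eulerContraction_smul]
    exact exists_formsMap_eq_smul_contraction hd hf hφ s (by simpa using hy)
  | zero => exact ⟨0, zero_mem _, by simp⟩
  | add ω η _ _ hω hη =>
    obtain ⟨x, hx, hx'⟩ := hω
    obtain ⟨y, hy, hy'⟩ := hη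
    exact ⟨x + y, add_mem hx hy, by rw [map_add, hx', hy', mul_add, map_add]⟩
  | smul c ω _ hω =>
    obtain ⟨x, hx, hx'⟩ := hω
    exact ⟨c • x, Submodule.smul_of_tower_mem _ c hx, by
      rw [map_smul, hx', mul_smul_comm, map_smul]⟩

lemma aeval_mul_right_of_isHomogeneous {S : Type*} [CommRing S] [Algebra ℂ S] {g : Poly n} {e : ℕ}
    (hg : g.IsHomogeneous e) (c : Fin (n + 1) → S) (w : S) :
    MvPolynomial.aeval (fun j => c j * w) g = MvPolynomial.aeval c g * w ^ e := by
  simp only [MvPolynomial.aeval_def, MvPolynomial.eval₂_eq', Finset.sum_mul]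
  refine Finset.sum_congr rfl fun m hm => ?_
  have h : ∑ i, m i = e := by
    rw [← hg (MvPolynomial.mem_support_iff.mp hm), Finsupp.weight_apply, Finsupp.sum_fintype]
    · simp
    · simp
  simp only [mul_pow, Finset.prod_mul_distrib, Finset.prod_pow_eq_pow_sum, h, mul_assoc]

lemma aeval_locX (g : Poly n) :
    MvPolynomial.aeval (locX f) g = algebraMap (Poly n) (PolyLoc f) g := by
  have h : MvPolynomial.aeval (locX f) = IsScalarTower.toAlgHom ℂ (Poly n) (PolyLoc f) :=
    MvPolynomial.algHom_ext fun i => by simp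
  rw [h]; rfl

/-- Let `a = xᵢ uᵢ`, a function of degree zero. Setting `xᵢ = 1` gives a map from `ℂ[x][f⁻¹]` to
`A[a⁻¹]` which on `A` is the localization map. -/
lemma exists_dehomogenization (hd : 0 < d) (hf : f.IsHomogeneous d)
    (hinj : Function.Injective φ) (hφ : ∀ y, IsLocHomogeneous f d y 0 ↔ ∃ a, φ a = y)
    (i : Fin (n + 1)) (t : A) (ht : φ t = locX f i * eulerDual f d i) :
    ∃ ψ : PolyLoc f →ₐ[ℂ] Localization.Away t,
      ψ.comp φ = IsScalarTower.toAlgHom ℂ A (Localization.Away t) := by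
  have hu := isLocHomogeneous_eulerDual hd hf i
  have h1 (j : Fin (n + 1)) : ∃ a, φ a = locX f j * eulerDual f d i :=
    (hφ _).mp ((IsLocHomogeneous.var _).mul hu)
  choose a ha using h1
  obtain ⟨c, hc⟩ : ∃ c, φ c = algebraMap (Poly n) (PolyLoc f) f * eulerDual f d i ^ d :=
    (hφ _).mp (by simpa using (IsLocHomogeneous.of_poly hf).mul (hu.pow d))
  obtain ⟨s, hs⟩ : ∃ s, φ s = locX f i ^ d * fInv f :=
    (hφ _).mp (by simpa using ((IsLocHomogeneous.var (f := f) (d := d) i).pow d).mul .inv)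
  -- So `c` becomes invertible in `A[t⁻¹]`; it is, up to a power of `t`, the image of `f`.
  have hcs : c * s = t ^ d := hinj (by
    rw [map_mul, map_pow, hc, hs, ht]
    linear_combination (eulerDual f d i ^ d * locX f i ^ d) * algebraMap_mul_fInv f)
  have hφa {g : Poly n} {e : ℕ} (hg : g.IsHomogeneous e) :
      φ (MvPolynomial.aeval a g) = algebraMap (Poly n) (PolyLoc f) g * eulerDual f d i ^ e := by
    rw [← AlgHom.comp_apply, MvPolynomial.comp_aeval, ← aeval_locX,
      ← aeval_mul_right_of_isHomogeneous hg]
    simp only [ha]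
  let B := Localization.Away t
  let w : B := IsLocalization.Away.invSelf t
  have hw : algebraMap A B t * w = 1 := IsLocalization.Away.mul_invSelf t
  let ψ₀ : Poly n →ₐ[ℂ] B := MvPolynomial.aeval fun j => algebraMap A B (a j) * w
  have hψ₀ {g : Poly n} {e : ℕ} (hg : g.IsHomogeneous e) :
      ψ₀ g = algebraMap A B (MvPolynomial.aeval a g) * w ^ e := by
    rw [show ψ₀ g = _ from aeval_mul_right_of_isHomogeneous hg _ w]
    exact congrArg (· * w ^ e) (MvPolynomial.aeval_algebraMap_apply B a g)
  have hac : MvPolynomial.aeval a f = c := hinj (by rw [hφa hf, hc])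
  have hunit : IsUnit (ψ₀ f) := by
    rw [hψ₀ hf, hac]
    refine IsUnit.of_mul_eq_one (algebraMap A B s) ?_
    rw [mul_right_comm, ← map_mul, hcs, map_pow, ← mul_pow, hw, one_pow]
  let ψ : PolyLoc f →ₐ[ℂ] B := IsLocalization.liftAlgHom (M := Submonoid.powers f) (f := ψ₀) (by
    rintro ⟨_, m, rfl⟩
    simpa using hunit.pow m)
  have hψ (g : Poly n) : ψ (algebraMap (Poly n) (PolyLoc f) g) = ψ₀ g :=
    IsLocalization.lift_eq _ g
  refine ⟨ψ, AlgHom.ext fun b => ?_⟩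
  -- Compare `b = g / f^m` with its image after clearing the denominator `f^m`.
  obtain ⟨e, m, g, hg, he, hb⟩ := (hφ (φ b)).mpr ⟨b, rfl⟩
  obtain rfl : e = d * m := by zify; rw [he]; ring
  have h2 : b * c ^ m = MvPolynomial.aeval a g := hinj (by
    rw [hφa hg, map_mul, map_pow, hb, hc, mul_pow, pow_mul]
    linear_combination (algebraMap (Poly n) (PolyLoc f) g * (eulerDual f d i ^ d) ^ m) *
      algebraMap_pow_mul_fInv_pow f m)
  have h3 : ψ (φ b) * ψ₀ f ^ m = algebraMap A B b * ψ₀ f ^ m := by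
    have h4 : φ b * algebraMap (Poly n) (PolyLoc f) f ^ m = algebraMap (Poly n) (PolyLoc f) g := by
      rw [hb]
      linear_combination (algebraMap (Poly n) (PolyLoc f) g) * algebraMap_pow_mul_fInv_pow f m
    rw [← hψ f, ← map_pow, ← map_mul, h4, map_pow, hψ, hψ, hψ₀ hg, hψ₀ hf, hac, ← h2, mul_pow,
      map_mul, map_pow, pow_mul, mul_assoc]
  exact (hunit.pow m).mul_right_cancel h3

/-- Pullback of forms from the functions of degree zero to `ℂ[x][f⁻¹]` is injective: it is so locally
on the open cover given by the functions `xᵢ uᵢ`, where it has a retraction. -/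
lemma formsMap_injective (hd : 0 < d) (hf : f.IsHomogeneous d)
    (hinj : Function.Injective φ) (hφ : ∀ y, IsLocHomogeneous f d y 0 ↔ ∃ a, φ a = y) :
    Function.Injective (formsMap φ) := by
  rw [injective_iff_map_eq_zero]
  intro x hx
  have h1 (i : Fin (n + 1)) : ∃ a, φ a = locX f i * eulerDual f d i :=
    (hφ _).mp ((IsLocHomogeneous.var _).mul (isLocHomogeneous_eulerDual hd hf i))
  choose t ht using h1
  have hsum : ∑ i, t i = 1 := hinj (by
    rw [map_sum, map_one, ← sum_locX_mul_eulerDual hd hf]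
    exact Finset.sum_congr rfl fun i _ => ht i)
  -- The annihilator of `x` contains a power of each `t i`.
  let J : Ideal A := LinearMap.ker (LinearMap.toSpanSingleton A (Forms ℂ A) x)
  have hJ (i : Fin (n + 1)) : t i ∈ J.radical := by
    obtain ⟨ψ, hψ⟩ := exists_dehomogenization hd hf hinj hφ i (t i) (ht i)
    have h2 : formsMap (IsScalarTower.toAlgHom ℂ A (Localization.Away (t i))) x = 0 := by
      rw [← hψ, formsMap_comp, hx, map_zero]
    exact exists_pow_smul_eq_zero_of_formsMap_eq_zero (t i) h2
  have h3 : (1 : A) ∈ J := by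
    rw [← Ideal.eq_top_iff_one, ← Ideal.radical_eq_top, Ideal.eq_top_iff_one, ← hsum]
    exact sum_mem fun i _ => hJ i
  simpa [J] using h3

end Descent

/-! ### Forms on the complement of the hypersurface -/

section FirstIsomorphism

open AlgebraicGeometry CategoryTheory

variable {n d : ℕ} {f : Poly n}

/-- The functions on `U` are the elements of degree zero in `ℂ[x][f⁻¹]`. -/
lemma isLocHomogeneous_zero_iff (hd : 0 < d) (hf : f.IsHomogeneous d) (y : PolyLoc f) :
    IsLocHomogeneous f d y 0 ↔ ∃ a, sectionsToLoc hf hd a = y := by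
  have hf' : f ∈ polyGrading n d := hf
  have hval (m : ℕ) (g : Poly n) (hg : g ∈ polyGrading n (m • d)) :
      (HomogeneousLocalization.Away.mk (polyGrading n) hf' m g hg).val =
        algebraMap (Poly n) (PolyLoc f) g * fInv f ^ m := by
    rw [HomogeneousLocalization.Away.val_mk, Localization.mk_eq_mk',
      IsLocalization.mk'_eq_iff_eq_mul, map_pow]
    linear_combination (-algebraMap (Poly n) (PolyLoc f) g) * algebraMap_pow_mul_fInv_pow f m
  constructor
  · rintro ⟨e, m, g, hg, he, rfl⟩
    obtain rfl : e = m • d := by zify; rw [he]; simp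
    refine ⟨(Proj.basicOpenIsoAway (polyGrading n) f hf hd).hom.hom
      (HomogeneousLocalization.Away.mk (polyGrading n) hf' m g hg), ?_⟩
    rw [← hval m g hg]
    change algebraMap (HomogeneousLocalization.Away (polyGrading n) f) (PolyLoc f)
      ((Proj.basicOpenIsoAway (polyGrading n) f hf hd).inv.hom _) = _
    rw [← CommRingCat.comp_apply, Iso.hom_inv_id]
    rfl
  · rintro ⟨a, rfl⟩
    obtain ⟨m, g, hg, h⟩ := HomogeneousLocalization.Away.mk_surjective (polyGrading n) hf'
      ((Proj.basicOpenIsoAway (polyGrading n) f hf hd).inv.hom a)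
    refine ⟨m • d, m, g, hg, by simp, ?_⟩
    rw [← hval m g hg, h]
    rfl

lemma sectionsToLoc_injective (hd : 0 < d) (hf : f.IsHomogeneous d) :
    Function.Injective (sectionsToLoc hf hd) := by
  have h1 : Function.Injective (Proj.basicOpenIsoAway (polyGrading n) f hf hd).inv.hom :=
    (ConcreteCategory.bijective_of_isIso (Proj.basicOpenIsoAway (polyGrading n) f hf hd).inv).1
  exact (HomogeneousLocalization.val_injective (Submonoid.powers f)).comp h1

lemma restrict_refl (V : (PP n).Opens) : PP.restrict (le_refl V) = AlgHom.id ℂ Γ(PP n, V) := by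
  ext a
  change ((PP n).presheaf.map (𝟙 _)).hom a = a
  rw [CategoryTheory.Functor.map_id]
  rfl

lemma restrict_comp {V W Z : (PP n).Opens} (h : W ≤ V) (h' : Z ≤ W) :
    (PP.restrict h').comp (PP.restrict h) = PP.restrict (h'.trans h) := by
  ext a
  change ((PP n).presheaf.map (homOfLE h').op).hom (((PP n).presheaf.map (homOfLE h).op).hom a) =
    ((PP n).presheaf.map (homOfLE (h'.trans h)).op).hom a
  rw [← CommRingCat.comp_apply, ← Functor.map_comp]
  rfl

/-- Families of forms on the affine opens of `U` that are compatible with restriction. -/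
def compatibleForms {n : ℕ} (U : (PP n).Opens) : Submodule ℂ (FormFamily U) where
  carrier := {ω | ∀ (V W : AffineIn U) (h : W.1 ≤ V.1), formsMap (PP.restrict h) (ω V) = ω W}
  zero_mem' := fun _ _ _ => map_zero _
  add_mem' {ω η} hω hη V W h := by
    rw [Pi.add_apply, map_add, hω, hη, Pi.add_apply]
  smul_mem' c ω hω V W h := by
    rw [Pi.smul_apply, map_smul, hω, Pi.smul_apply]

lemma openForms_le_compatibleForms (U : (PP n).Opens) (j : ℕ) :
    openForms U j ≤ compatibleForms U := fun _ hω => hω.2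

lemma openFormDeriv_mem_compatibleForms {U : (PP n).Opens} {ω : FormFamily U}
    (hω : ω ∈ compatibleForms U) : openFormDeriv U ω ∈ compatibleForms U := by
  intro V W h
  change formsMap _ (formDeriv ℂ _ (ω V)) = formDeriv ℂ _ (ω W)
  rw [formsMap_formDeriv, hω V W h]

lemma exists_mem_openForms (hd : 0 < d) (hf : f.IsHomogeneous d) {j : ℕ}
    {x : Forms ℂ Γ(PP n, hypersurfaceCompl f)}
    (hx : x ∈ ⋀[Γ(PP n, hypersurfaceCompl f)]^j (Ω[Γ(PP n, hypersurfaceCompl f)⁄ℂ])) :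
    ∃ ω ∈ openForms (hypersurfaceCompl f) j, ω (affineTop hf hd) = x := by
  refine ⟨fun V => formsMap (PP.restrict V.2.2) x, ⟨fun V => formsMap_mem_exteriorPower _ hx,
    fun V W h => ?_⟩, ?_⟩
  · rw [← formsMap_comp, restrict_comp]
  · change formsMap (PP.restrict (le_refl _)) x = x
    rw [restrict_refl, formsMap_id]

/-- `ω ↦ (df/f) ∧ π^*ω`. -/
def dlogPullback (hd : 0 < d) (hf : f.IsHomogeneous d) :
    FormFamily (hypersurfaceCompl f) →ₗ[ℂ] Forms ℂ (PolyLoc f) :=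
  LinearMap.mulLeft ℂ (dlog f) ∘ₗ (formsMap (sectionsToLoc hf hd)).toLinearMap ∘ₗ
    LinearMap.proj (affineTop hf hd)

lemma dlogPullback_apply (hd : 0 < d) (hf : f.IsHomogeneous d)
    (ω : FormFamily (hypersurfaceCompl f)) :
    dlogPullback hd hf ω = dlog f * pullbackForm hf hd ω := rfl

lemma pullbackForm_mem_xiForms (hd : 0 < d) (hf : f.IsHomogeneous d) {j : ℕ}
    {ω : FormFamily (hypersurfaceCompl f)} (hω : ω ∈ openForms (hypersurfaceCompl f) j) :
    pullbackForm hf hd ω ∈ xiForms f d j :=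
  formsMap_mem_xiForms hd hf (fun a => (isLocHomogeneous_zero_iff hd hf _).mpr ⟨a, rfl⟩)
    (hω.1 (affineTop hf hd))

lemma eq_zero_of_dlogPullback_eq_zero (hd : 0 < d) (hf : f.IsHomogeneous d)
    {ω : FormFamily (hypersurfaceCompl f)} (hω : ω ∈ compatibleForms (hypersurfaceCompl f))
    (h : dlogPullback hd hf ω = 0) : ω = 0 := by
  have hφ (a) := (isLocHomogeneous_zero_iff hd hf _).mpr ⟨a, rfl⟩
  have h1 : formsMap (sectionsToLoc hf hd) (ω (affineTop hf hd)) = 0 := by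
    have h2 := eulerContraction_dlog_mul hd hf (pullbackForm hf hd ω)
    rw [show eulerContraction f d (pullbackForm hf hd ω) = 0 from
      eulerContraction_formsMap hd hf hφ _, mul_zero, sub_zero, ← dlogPullback_apply, h,
      map_zero] at h2
    exact h2.symm
  have h3 : ω (affineTop hf hd) = 0 :=
    formsMap_injective hd hf (sectionsToLoc_injective hd hf) (isLocHomogeneous_zero_iff hd hf)
      (h1.trans (map_zero _).symm)
  funext V
  rw [← hω (affineTop hf hd) V V.2.2, h3, map_zero, Pi.zero_apply]

lemma map_dlogPullback_openForms (hd : 0 < d) (hf : f.IsHomogeneous d) (j : ℕ) :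
    (openForms (hypersurfaceCompl f) j).map (dlogPullback hd hf) = dlogXiForms f d j := by
  apply le_antisymm
  · rintro _ ⟨ω, hω, rfl⟩
    exact ⟨_, pullbackForm_mem_xiForms hd hf hω, rfl⟩
  · rintro _ ⟨θ, hθ, rfl⟩
    obtain ⟨x, hx, rfl⟩ := exists_formsMap_eq_of_mem_xiForms hd hf
      (fun y => (isLocHomogeneous_zero_iff hd hf y).mp) hθ
    obtain ⟨η, hη, rfl⟩ := exists_mem_openForms hd hf hx
    exact ⟨η, hη, rfl⟩

lemma dlogPullback_openFormDeriv (hd : 0 < d) (hf : f.IsHomogeneous d)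
    (ω : FormFamily (hypersurfaceCompl f)) :
    dlogPullback hd hf (openFormDeriv _ ω) = (-formDeriv ℂ (PolyLoc f)) (dlogPullback hd hf ω) := by
  rw [LinearMap.neg_apply, dlogPullback_apply, dlogPullback_apply, formDeriv_dlog_mul, neg_neg]
  exact congrArg (dlog f * ·) (formsMap_formDeriv (sectionsToLoc hf hd) _)

end FirstIsomorphism

/-- Pullback to the complement of the cone identifies the de Rham complex of `U` with the complex
`(df/f) ∧ Ω^•[f⁻¹]_0^{(ξ)}`. -/
lemma exists_openForms_cohomology_equiv {n d : ℕ} {f : Poly n} (hd : 0 < d)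
    (hf : f.IsHomogeneous d) (j : ℕ) :
    ∃ e : Cohomology (openForms (hypersurfaceCompl f)) (openFormDeriv (hypersurfaceCompl f)) j
        ≃ₗ[ℂ] Cohomology (dlogXiForms f d) (-formDeriv ℂ (PolyLoc f)) j,
      ∀ ω : cocycles (openForms (hypersurfaceCompl f)) (openFormDeriv (hypersurfaceCompl f)) j,
        ∃ h : dlog f * pullbackForm hf hd ω ∈
            cocycles (dlogXiForms f d) (-formDeriv ℂ (PolyLoc f)) j,
          e (Cohomology.mk _ _ j ω) = Cohomology.mk _ _ j ⟨dlog f * pullbackForm hf hd ω, h⟩ :=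
  exists_cohomology_equiv (C := openForms (hypersurfaceCompl f))
    (δ := openFormDeriv (hypersurfaceCompl f)) (D := dlogXiForms f d)
    (δ' := -formDeriv ℂ (PolyLoc f)) (dlogPullback hd hf) (compatibleForms (hypersurfaceCompl f))
    (fun j => openForms_le_compatibleForms _ j)
    (fun _ hω => openFormDeriv_mem_compatibleForms hω)
    (fun _ hω h => eq_zero_of_dlogPullback_eq_zero hd hf hω h)
    (fun j => map_dlogPullback_openForms hd hf j) (dlogPullback_openFormDeriv hd hf) j

/-! ### Homogeneous polynomial forms -/

section PolynomialForms

variable {n : ℕ}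

lemma formsMap_dxMonomial (f : Poly n) {j : ℕ} (s : Fin j → Fin (n + 1)) :
    formsMap (IsScalarTower.toAlgHom ℂ (Poly n) (PolyLoc f)) (dxMonomial (Poly n) s) =
      dxMonomial (PolyLoc f) s := by
  simp only [dxMonomial, ExteriorAlgebra.ιMulti_apply, map_list_prod, List.map_ofFn]
  congr 2
  funext i
  exact formsMap_dOf _ _

/-- The polynomial `j`-forms are the sums of homogeneous ones. -/
lemma polyForms_le_iSup (n j : ℕ) : polyForms n j ≤ ⨆ e, polyFormsDeg n j e := by
  have hgen (g : Poly n) (s : Fin j → Fin (n + 1)) :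
      g • dxMonomial (Poly n) s ∈ ⨆ e, polyFormsDeg n j e := by
    rw [← MvPolynomial.sum_homogeneousComponent g, Finset.sum_smul]
    refine sum_mem fun i _ => Submodule.mem_iSup_of_mem (i + j) (Submodule.subset_span ?_)
    exact ⟨i, _, s, MvPolynomial.homogeneousComponent_isHomogeneous i g, rfl, rfl⟩
  intro x hx
  have hx' : x ∈ ⋀[Poly n]^j (Ω[Poly n⁄ℂ]) := hx
  clear hx
  rw [← exteriorPower.ιMulti_span_fixedDegree_of_span_eq_top (Poly n) j _
    (KaehlerDifferential.mvPolynomialBasis ℂ (Fin (n + 1))).span_eq] at hx'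
  induction hx' using Submodule.closure_induction with
  | zero => exact zero_mem _
  | add x y hx hy h h' => exact add_mem h h'
  | smul_mem g x hx =>
    obtain ⟨v, hv, rfl⟩ := hx
    choose s hs using fun i => hv (Set.mem_range_self i)
    have h : ExteriorAlgebra.ιMulti (Poly n) j v = dxMonomial (Poly n) s := by
      rw [dxMonomial]
      congr 1
      funext i
      rw [← hs i, KaehlerDifferential.mvPolynomialBasis_apply]
      rfl
    rw [h]
    exact hgen g s

/-- The pullback by the homothety `x ↦ 2x`. It multiplies forms of degree `k` by `2^k`, so the forms of
different degrees are linearly independent. -/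
def dilation (n : ℕ) : Poly n →ₐ[ℂ] Poly n :=
  MvPolynomial.aeval fun i => (2 : ℂ) • (MvPolynomial.X i : Poly n)

lemma dilation_apply {g : Poly n} {e : ℕ} (hg : g.IsHomogeneous e) :
    dilation n g = (2 : ℂ) ^ e • g := by
  have h := aeval_mul_right_of_isHomogeneous hg (MvPolynomial.X : Fin (n + 1) → Poly n)
    (algebraMap ℂ (Poly n) 2)
  rw [MvPolynomial.aeval_X_left, AlgHom.id_apply, ← map_pow] at h
  rw [Algebra.smul_def, mul_comm, ← h]
  simp only [dilation, Algebra.smul_def, mul_comm]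

lemma formsMap_dilation {j k : ℕ} {ω : Forms ℂ (Poly n)} (hω : ω ∈ polyFormsDeg n j k) :
    formsMap (dilation n) ω = (2 : ℂ) ^ k • ω := by
  induction hω using Submodule.span_induction with
  | mem x hx =>
    obtain ⟨e, g, s, hg, rfl, rfl⟩ := hx
    have h (j : ℕ) (s : Fin j → Fin (n + 1)) :
        formsMap (dilation n) (dxMonomial (Poly n) s) = (2 : ℂ) ^ j • dxMonomial (Poly n) s := by
      induction j with
      | zero => simp [dxMonomial]
      | succ j ih =>
        have h1 : dxMonomial (Poly n) s = dOf ℂ (Poly n) (MvPolynomial.X (s 0)) *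
            dxMonomial (Poly n) (Fin.tail s) := by
          rw [dxMonomial, ExteriorAlgebra.ιMulti_succ_apply]
          rfl
        rw [h1, map_mul, ih, formsMap_dOf, dilation_apply (MvPolynomial.isHomogeneous_X ℂ _),
          dOf_smul, smul_mul_smul_comm, pow_one, ← pow_succ']
    rw [formsMap_smul, dilation_apply hg, h, smul_assoc, smul_comm g, smul_smul, ← pow_add]
  | zero => simp
  | add x y _ _ hx hy => rw [map_add, hx, hy, smul_add]
  | smul c x _ hx => rw [map_smul, hx, smul_comm]

/-- If `df ∧ dσ` is homogeneous, then `σ` may be replaced by a homogeneous form. -/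
lemma exists_homogeneous_of_eq_dOf_mul {d : ℕ} {f : Poly n} (hf : f.IsHomogeneous d) {i j k : ℕ}
    {σ : Forms ℂ (Poly n)} (hσ : σ ∈ polyForms n i)
    (h : dOf ℂ (Poly n) f * formDeriv ℂ (Poly n) σ ∈ polyFormsDeg n j k) :
    dOf ℂ (Poly n) f * formDeriv ℂ (Poly n) σ = 0 ∨
    ∃ e, e + d = k ∧ ∃ τ ∈ polyFormsDeg n i e, dOf ℂ (Poly n) f * formDeriv ℂ (Poly n) τ =
      dOf ℂ (Poly n) f * formDeriv ℂ (Poly n) σ := by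
  let S : Module.End ℂ (Forms ℂ (Poly n)) := (formsMap (dilation n)).toLinearMap
  let V : ℕ → Submodule ℂ (Forms ℂ (Poly n)) := fun e => S.eigenspace (2 ^ e)
  have hV : iSupIndep V := S.eigenspaces_iSupIndep.comp fun a b hab => by
    have : (2 : ℕ) ^ a = 2 ^ b := by exact_mod_cast hab
    exact Nat.pow_right_injective le_rfl this
  let R : Forms ℂ (Poly n) →ₗ[ℂ] Forms ℂ (Poly n) :=
    LinearMap.mulLeft ℂ (dOf ℂ (Poly n) f) ∘ₗ formDeriv ℂ (Poly n)
  have hR {e : ℕ} {τ : Forms ℂ (Poly n)} (hτ : τ ∈ polyFormsDeg n i e) : R τ ∈ V (e + d) := by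
    rw [Module.End.mem_eigenspace_iff]
    change formsMap (dilation n) (dOf ℂ (Poly n) f * formDeriv ℂ (Poly n) τ) =
      _ • (dOf ℂ (Poly n) f * formDeriv ℂ (Poly n) τ)
    rw [map_mul, formsMap_dOf, dilation_apply hf, dOf_smul, formsMap_formDeriv,
      formsMap_dilation hτ, map_smul, smul_mul_smul_comm, ← pow_add, add_comm d]
  have hη : R σ ∈ V k := Module.End.mem_eigenspace_iff.mpr (formsMap_dilation h)
  obtain ⟨c, hc⟩ := (Submodule.mem_iSup_iff_exists_finsupp _ _).mp (polyForms_le_iSup n i hσ)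
  obtain ⟨hc, hsum⟩ := hc
  have hsum' : R σ = ∑ e ∈ c.support, R (c e) := by
    rw [← hsum, Finsupp.sum, map_sum]
  -- All components but the one of degree `k` lie in the other eigenspaces.
  have key : ∀ e₀ ∈ c.support, e₀ + d = k → R (c e₀) = R σ := by
    intro e₀ he₀ hk
    rw [← sub_eq_zero]
    refine Submodule.disjoint_def.mp (hV k) _ (sub_mem (hk ▸ hR (hc e₀)) hη) ?_
    rw [hsum', ← Finset.add_sum_erase _ _ he₀, sub_add_cancel_left]
    refine neg_mem (sum_mem fun e he => ?_)
    have hne : e + d ≠ k := by have := Finset.ne_of_mem_erase he; omega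
    exact Submodule.mem_iSup_of_mem (e + d) (Submodule.mem_iSup_of_mem hne (hR (hc e)))
  by_cases hex : ∃ e₀ ∈ c.support, e₀ + d = k
  · obtain ⟨e₀, he₀, hk⟩ := hex
    exact Or.inr ⟨e₀, hk, c e₀, hc e₀, key e₀ he₀ hk⟩
  · left
    refine Submodule.disjoint_def.mp (hV k) _ hη ?_
    change R σ ∈ _
    rw [hsum']
    refine sum_mem fun e he => ?_
    have hne : e + d ≠ k := fun hk => hex ⟨e, he, hk⟩
    exact Submodule.mem_iSup_of_mem (e + d) (Submodule.mem_iSup_of_mem hne (hR (hc e)))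

end PolynomialForms

/-! ### Pole order -/

section PoleOrder

variable {n d : ℕ} {f : Poly n}

lemma divPow_apply (k : ℕ) (η : Forms ℂ (Poly n)) : divPow f k η =
    fInv f ^ k • formsMap (IsScalarTower.toAlgHom ℂ (Poly n) (PolyLoc f)) η := rfl

lemma divPow_add_pow_smul (k m : ℕ) (η : Forms ℂ (Poly n)) :
    divPow f (k + m) (f ^ m • η) = divPow f k η := by
  rw [divPow_apply, divPow_apply, formsMap_smul, smul_smul, map_pow, pow_add, mul_assoc,
    mul_comm (fInv f ^ m)]
  change (fInv f ^ k * (algebraMap (Poly n) (PolyLoc f) f ^ m * fInv f ^ m)) • _ = _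
  rw [algebraMap_pow_mul_fInv_pow, mul_one]

lemma divPow_mem_locFormsDeg {j k : ℕ} {η : Forms ℂ (Poly n)}
    (hη : η ∈ polyFormsDeg n j (k * d)) : divPow f k η ∈ locFormsDeg f d j 0 := by
  induction hη using Submodule.span_induction with
  | mem x hx =>
    obtain ⟨e, g, s, hg, he, rfl⟩ := hx
    refine Submodule.subset_span ⟨e, k, g, s, hg, by zify at he; rw [he]; ring, ?_⟩
    rw [divPow_apply, formsMap_smul, formsMap_dxMonomial, smul_smul, mul_comm]
    rfl
  | zero => rw [map_zero]; exact zero_mem _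
  | add x y _ _ hx hy => rw [map_add]; exact add_mem hx hy
  | smul c x _ hx => rw [map_smul]; exact Submodule.smul_mem _ c hx

lemma pow_smul_mem_polyFormsDeg (hf : f.IsHomogeneous d) {j k : ℕ} {ω : Forms ℂ (Poly n)}
    (hω : ω ∈ polyFormsDeg n j (k * d)) (m : ℕ) :
    f ^ m • ω ∈ polyFormsDeg n j ((k + m) * d) := by
  induction m with
  | zero => simpa using hω
  | succ m ih =>
    rw [pow_succ', mul_smul, ← add_assoc, Nat.succ_mul]
    exact smul_mem_polyFormsDeg hf ih

lemma polyFormsDeg_le_polyForms (n j k : ℕ) : polyFormsDeg n j k ≤ polyForms n j := by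
  rw [polyFormsDeg, Submodule.span_le]
  rintro _ ⟨e, g, s, -, -, rfl⟩
  exact Submodule.smul_mem (⋀[Poly n]^j (Ω[Poly n⁄ℂ])) g
    (exteriorPower.ιMulti (Poly n) j (M := Ω[Poly n⁄ℂ]) _).2

/-- A form of degree zero is a fraction `η / f^k`, with `η` a homogeneous polynomial form. -/
lemma exists_divPow_eq (hf : f.IsHomogeneous d) {j : ℕ} {ω : Forms ℂ (PolyLoc f)}
    (hω : ω ∈ locFormsDeg f d j 0) :
    ∃ k, ∃ η ∈ polyFormsDeg n j (k * d), divPow f k η = ω := by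
  induction hω using Submodule.span_induction with
  | mem x hx =>
    obtain ⟨e, m, g, s, hg, he, rfl⟩ := hx
    refine ⟨m, g • dxMonomial (Poly n) s, Submodule.subset_span
      ⟨e, g, s, hg, by zify; rw [he]; ring, rfl⟩, ?_⟩
    rw [divPow_apply, formsMap_smul, formsMap_dxMonomial, smul_smul, mul_comm]
    rfl
  | zero => exact ⟨0, 0, zero_mem _, map_zero _⟩
  | add x y _ _ hx hy =>
    obtain ⟨k, η, hη, rfl⟩ := hx
    obtain ⟨l, θ, hθ, rfl⟩ := hy
    refine ⟨k + l, f ^ l • η + f ^ k • θ, add_mem (pow_smul_mem_polyFormsDeg hf hη l) ?_, ?_⟩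
    · rw [add_comm k]; exact pow_smul_mem_polyFormsDeg hf hθ k
    · rw [map_add, divPow_add_pow_smul, add_comm k, divPow_add_pow_smul]
  | smul c x _ hx =>
    obtain ⟨k, η, hη, rfl⟩ := hx
    exact ⟨k, c • η, Submodule.smul_mem _ c hη, map_smul _ _ _⟩

/-- `(df/f) ∧ d(σ/f^k) = (df ∧ dσ)/f^(k+1)`, because `df ∧ d(f^{-k}) = 0`. -/
lemma dlog_mul_formDeriv_divPow (k : ℕ) (σ : Forms ℂ (Poly n)) :
    dlog f * formDeriv ℂ (PolyLoc f) (divPow f k σ) =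
      divPow f (k + 1) (dOf ℂ (Poly n) f * formDeriv ℂ (Poly n) σ) := by
  have h (k : ℕ) : ∃ c : PolyLoc f, dOf ℂ (PolyLoc f) (fInv f ^ k) = c • dlog f := by
    induction k with
    | zero => exact ⟨0, by rw [pow_zero, ← map_one (algebraMap ℂ (PolyLoc f)), dOf_algebraMap,
        zero_smul]⟩
    | succ k ih =>
      obtain ⟨c, hc⟩ := ih
      refine ⟨-(fInv f ^ k * fInv f) + fInv f * c, ?_⟩
      rw [pow_succ, dOf_mul, hc, dOf_fInv, add_smul, mul_smul (fInv f), neg_smul, dlog, smul_neg,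
        smul_smul, smul_smul (_ * _), pow_two, mul_assoc]
  obtain ⟨c, hc⟩ := h k
  rw [divPow_apply, divPow_apply, formDeriv_smul, hc, mul_add, smul_mul_assoc, mul_smul_comm,
    dlog_mul_dlog_mul, smul_zero, zero_add, map_mul, formsMap_dOf, formsMap_formDeriv, dlog,
    smul_mul_assoc, mul_smul_comm, smul_smul, pow_succ']
  rfl

lemma mem_cocycles_dlogXiForms_iff (hd : 0 < d) (hf : f.IsHomogeneous d)
    {ω : Forms ℂ (PolyLoc f)} :
    ω ∈ cocycles (dlogXiForms f d) (-formDeriv ℂ (PolyLoc f)) n ↔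
      ω ∈ locFormsDeg f d (n + 1) 0 := by
  constructor
  · rintro ⟨⟨η, hη, rfl⟩, -⟩
    exact dlog_mul_mem_locFormsDeg hd hf ((mem_xiForms_iff hd hf).mp hη).1
  · intro h
    refine ⟨⟨eulerContraction f d ω, ⟨ω, h, rfl⟩, ?_⟩, ?_⟩
    · have h1 := eulerContraction_dlog_mul hd hf ω
      rw [dlog_mul_eq_zero_of_top hd hf h, map_zero] at h1
      exact (sub_eq_zero.mp h1.symm).symm
    · exact neg_eq_zero.mpr (formDeriv_eq_zero_of_top hd hf h)

/-- The coboundaries of `(df/f) ∧ Ω^•[f⁻¹]_0^{(ξ)}` in degree `j` are the forms `(df/f) ∧ dω` with `ω`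
of degree zero: `ω` and its horizontal part differ by a multiple of `df/f`. -/
lemma mem_coboundaries_dlogXiForms_iff (hd : 0 < d) (hf : f.IsHomogeneous d) {j : ℕ}
    (hj : 0 < j) {ω : Forms ℂ (PolyLoc f)} :
    ω ∈ coboundaries (dlogXiForms f d) (-formDeriv ℂ (PolyLoc f)) j ↔
      ∃ σ ∈ locFormsDeg f d (j - 1) 0, dlog f * formDeriv ℂ (PolyLoc f) σ = ω := by
  rw [coboundaries_eq_map _ _ hj]
  constructor
  · rintro ⟨_, ⟨σ, hσ, rfl⟩, rfl⟩
    refine ⟨σ, ((mem_xiForms_iff hd hf).mp hσ).1, ?_⟩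
    rw [LinearMap.neg_apply, LinearMap.mulLeft_apply, formDeriv_dlog_mul, neg_neg]
  · rintro ⟨σ, hσ, rfl⟩
    refine ⟨_, ⟨eulerContraction f d (dlog f * σ),
      ⟨_, dlog_mul_mem_locFormsDeg hd hf hσ, rfl⟩, rfl⟩, ?_⟩
    rw [LinearMap.neg_apply, LinearMap.mulLeft_apply, formDeriv_dlog_mul, neg_neg,
      eulerContraction_dlog_mul hd hf, map_sub, formDeriv_dlog_mul, mul_sub, mul_neg,
      dlog_mul_dlog_mul, neg_zero, sub_zero]

/-- A homogeneous relation `η = df ∧ dσ` of degree `k d` makes `η / f^k` a coboundary. -/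
lemma divPow_mem_coboundaries (hd : 0 < d) (hf : f.IsHomogeneous d) (hn : 0 < n) {k : ℕ}
    {η : Forms ℂ (Poly n)} (hη : η ∈ polyFormsDeg n (n + 1) (k * d)) (hrel : η ∈ brieskornRel f) :
    divPow f k η ∈ coboundaries (dlogXiForms f d) (-formDeriv ℂ (PolyLoc f)) n := by
  obtain ⟨_, hy, rfl⟩ := hrel
  obtain ⟨σ, hσ, rfl⟩ := (coboundaries_eq_map (polyForms n) _ hn).le hy
  rw [LinearMap.mulLeft_apply] at hη ⊢
  obtain h | ⟨e, he, τ, hτ, h⟩ := exists_homogeneous_of_eq_dOf_mul hf hσ hη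
  · rw [h, map_zero]; exact zero_mem _
  -- As `e + d = k d` with `d > 0`, the exponent `k` is positive.
  · obtain ⟨l, rfl⟩ : ∃ l, k = l + 1 := by
      refine ⟨k - 1, ?_⟩
      rcases k.eq_zero_or_pos with rfl | hk
      · omega
      · omega
    obtain rfl : e = l * d := by rw [Nat.succ_mul] at he; omega
    rw [← h, ← dlog_mul_formDeriv_divPow]
    exact (mem_coboundaries_dlogXiForms_iff hd hf hn).mpr ⟨_, divPow_mem_locFormsDeg hτ, rfl⟩

/-- If `η / f^k` is a coboundary, then `η` is killed in the Brieskorn module by a power of `f`. -/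
lemma exists_pow_smul_mem_brieskornRel (hd : 0 < d) (hf : f.IsHomogeneous d) (hn : 0 < n) {k : ℕ}
    {η : Forms ℂ (Poly n)}
    (h : divPow f k η ∈ coboundaries (dlogXiForms f d) (-formDeriv ℂ (PolyLoc f)) n) :
    ∃ N, f ^ N • η ∈ brieskornRel f := by
  obtain ⟨ω, hω, h1⟩ := (mem_coboundaries_dlogXiForms_iff hd hf hn).mp h
  obtain ⟨m, σ, hσ, rfl⟩ := exists_divPow_eq hf hω
  rw [dlog_mul_formDeriv_divPow] at h1
  have h2 : divPow f (k + (m + 1)) (f ^ (m + 1) • η -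
      f ^ k • (dOf ℂ (Poly n) f * formDeriv ℂ (Poly n) σ)) = 0 := by
    rw [map_sub, divPow_add_pow_smul, add_comm k, divPow_add_pow_smul, h1, sub_self]
  have h3 : formsMap (IsScalarTower.toAlgHom ℂ (Poly n) (PolyLoc f)) (f ^ (m + 1) • η -
      f ^ k • (dOf ℂ (Poly n) f * formDeriv ℂ (Poly n) σ)) = 0 := by
    rw [divPow_apply] at h2
    have h4 := congrArg (algebraMap (Poly n) (PolyLoc f) f ^ (k + (m + 1)) • ·) h2
    simpa only [smul_smul, algebraMap_pow_mul_fInv_pow, one_smul, smul_zero] using h4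
  obtain ⟨N, hN⟩ := exists_pow_smul_eq_zero_of_formsMap_eq_zero f h3
  refine ⟨N + (m + 1), ?_⟩
  rw [smul_sub, smul_smul, ← pow_add, sub_eq_zero] at hN
  rw [hN]
  have h5 : dOf ℂ (Poly n) f * formDeriv ℂ (Poly n) σ ∈ brieskornRel f := by
    exact ⟨formDeriv ℂ (Poly n) σ, (coboundaries_eq_map (polyForms n) _ hn).ge
      ⟨σ, polyFormsDeg_le_polyForms _ _ _ hσ, rfl⟩, rfl⟩
  rw [smul_smul, ← pow_add]
  generalize N + k = M
  induction M with
  | zero => simpa using h5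
  | succ M ih => rw [pow_succ', mul_smul]; exact smul_mem_brieskornRel f ih

end PoleOrder

/-! ### The direct limit of Brieskorn modules -/

section SecondIsomorphism

variable {n d : ℕ} {f : Poly n}

lemma mulF_pow_mk (m : ℕ) (η : polyForms n (n + 1)) :
    (Brieskorn.mulF f ^ m) (Brieskorn.mk f η) =
      Brieskorn.mk f ⟨f ^ m • (η : Forms ℂ (Poly n)),
        Submodule.smul_mem (⋀[Poly n]^(n + 1) (Ω[Poly n⁄ℂ])) (f ^ m) η.2⟩ := by
  induction m with
  | zero => simp
  | succ m ih =>
    rw [pow_succ', Module.End.mul_apply, ih]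
    change Brieskorn.mk f _ = _
    congr 1
    ext1
    change f • f ^ m • (η : Forms ℂ (Poly n)) = _
    rw [smul_smul, ← pow_succ']

lemma mk_eq_zero_iff (η : polyForms n (n + 1)) :
    Brieskorn.mk f η = 0 ↔ (η : Forms ℂ (Poly n)) ∈ brieskornRel f :=
  Submodule.Quotient.mk_eq_zero _

lemma transition_mk (hf : f.IsHomogeneous d) (k m : ℕ) {η : polyForms n (n + 1)}
    (hη : (η : Forms ℂ (Poly n)) ∈ polyFormsDeg n (n + 1) (k * d)) :
    Brieskorn.transition hf k (k + m) (Nat.le_add_right k m)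
        ⟨Brieskorn.mk f η, Submodule.mem_map_of_mem hη⟩ =
      ⟨Brieskorn.mk f ⟨f ^ m • (η : Forms ℂ (Poly n)),
        Submodule.smul_mem (⋀[Poly n]^(n + 1) (Ω[Poly n⁄ℂ])) (f ^ m) η.2⟩,
        Submodule.mem_map_of_mem (pow_smul_mem_polyFormsDeg hf hη m)⟩ := by
  ext1
  change (Brieskorn.mulF f ^ (k + m - k)) (Brieskorn.mk f η) = _
  rw [Nat.add_sub_cancel_left]
  exact mulF_pow_mk m η

/-- The class of `η / f^k` in cohomology depends only on the class of `η` in the Brieskorn module. -/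
lemma exists_degMap (hd : 0 < d) (hf : f.IsHomogeneous d) (hn : 0 < n) (k : ℕ) :
    ∃ F : Brieskorn.deg f (k * d) →ₗ[ℂ]
        Cohomology (dlogXiForms f d) (-formDeriv ℂ (PolyLoc f)) n,
      ∀ (η : polyForms n (n + 1)) (hη : (η : Forms ℂ (Poly n)) ∈ polyFormsDeg n (n + 1) (k * d)),
        F ⟨Brieskorn.mk f η, Submodule.mem_map_of_mem hη⟩ = Cohomology.mk _ _ n
          ⟨divPow f k η, (mem_cocycles_dlogXiForms_iff hd hf).mpr (divPow_mem_locFormsDeg hη)⟩ := by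
  let M := (polyFormsDeg n (n + 1) (k * d)).submoduleOf (polyForms n (n + 1))
  let p : M →ₗ[ℂ] Brieskorn.deg f (k * d) :=
    (Brieskorn.mk f).restrict fun η hη => Submodule.mem_map_of_mem hη
  let q : M →ₗ[ℂ] Cohomology (dlogXiForms f d) (-formDeriv ℂ (PolyLoc f)) n :=
    ((coboundaries (dlogXiForms f d) (-formDeriv ℂ (PolyLoc f)) n).submoduleOf
      (cocycles (dlogXiForms f d) (-formDeriv ℂ (PolyLoc f)) n)).mkQ ∘ₗ
      LinearMap.codRestrict _ (divPow f k ∘ₗ (polyForms n (n + 1)).subtype ∘ₗ M.subtype)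
        fun η => (mem_cocycles_dlogXiForms_iff hd hf).mpr (divPow_mem_locFormsDeg η.2)
  have hp : Function.Surjective p := by
    rintro ⟨_, η, hη, rfl⟩
    exact ⟨⟨η, hη⟩, rfl⟩
  obtain ⟨r, hr⟩ := exists_factorization (K := ℂ) (M := M) p hp q fun x hx => by
    have h1 : Brieskorn.mk f x.1 = 0 := congrArg Subtype.val (LinearMap.mem_ker.mp hx)
    exact (Submodule.Quotient.mk_eq_zero _).mpr
      (divPow_mem_coboundaries hd hf hn x.2 ((mk_eq_zero_iff _).mp h1))
  exact ⟨r, fun η hη => hr ⟨η, hη⟩⟩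

/-- The map `[η] ↦ [η / f^k]` from the part of degree `k d` of the Brieskorn module to cohomology. -/
def degMap (hd : 0 < d) (hf : f.IsHomogeneous d) (hn : 0 < n) (k : ℕ) :
    Brieskorn.deg f (k * d) →ₗ[ℂ] Cohomology (dlogXiForms f d) (-formDeriv ℂ (PolyLoc f)) n :=
  (exists_degMap hd hf hn k).choose

lemma degMap_mk (hd : 0 < d) (hf : f.IsHomogeneous d) (hn : 0 < n) (k : ℕ)
    {η : polyForms n (n + 1)} (hη : (η : Forms ℂ (Poly n)) ∈ polyFormsDeg n (n + 1) (k * d)) :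
    degMap hd hf hn k ⟨Brieskorn.mk f η, Submodule.mem_map_of_mem hη⟩ = Cohomology.mk _ _ n
      ⟨divPow f k η, (mem_cocycles_dlogXiForms_iff hd hf).mpr (divPow_mem_locFormsDeg hη)⟩ :=
  (exists_degMap hd hf hn k).choose_spec η hη

lemma degMap_transition (hd : 0 < d) (hf : f.IsHomogeneous d) (hn : 0 < n) (i j : ℕ) (hij : i ≤ j)
    (x : Brieskorn.deg f (i * d)) :
    degMap hd hf hn j (Brieskorn.transition hf i j hij x) = degMap hd hf hn i x := by
  obtain ⟨_, η, hη, rfl⟩ := x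
  obtain ⟨m, rfl⟩ := Nat.exists_eq_add_of_le hij
  refine (congrArg (degMap hd hf hn (i + m)) (transition_mk hf i m hη)).trans
    ((degMap_mk hd hf hn (i + m) (pow_smul_mem_polyFormsDeg hf hη m)).trans
      (Eq.trans ?_ (degMap_mk hd hf hn i hη).symm))
  congr 1
  ext1
  exact divPow_add_pow_smul i m _

lemma exists_transition_eq_zero (hd : 0 < d) (hf : f.IsHomogeneous d) (hn : 0 < n) (k : ℕ)
    (x : Brieskorn.deg f (k * d)) (hx : degMap hd hf hn k x = 0) :
    ∃ j hij, Brieskorn.transition hf k j hij x = 0 := by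
  obtain ⟨_, η, hη, rfl⟩ := x
  have h1 := (cohomology_mk_eq_zero_iff _).mp ((degMap_mk hd hf hn k hη).symm.trans hx)
  obtain ⟨N, hN⟩ := exists_pow_smul_mem_brieskornRel hd hf hn h1
  exact ⟨k + N, Nat.le_add_right k N,
    (transition_mk hf k N hη).trans (Subtype.ext ((mk_eq_zero_iff _).mpr hN))⟩

lemma exists_degMap_eq (hd : 0 < d) (hf : f.IsHomogeneous d) (hn : 0 < n)
    (z : Cohomology (dlogXiForms f d) (-formDeriv ℂ (PolyLoc f)) n) :
    ∃ k x, degMap hd hf hn k x = z := by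
  obtain ⟨ω, hω, rfl⟩ := cohomology_mk_surjective _ _ _ z
  obtain ⟨k, η, hη, rfl⟩ := exists_divPow_eq hf ((mem_cocycles_dlogXiForms_iff hd hf).mp hω)
  let θ : polyForms n (n + 1) := ⟨η, polyFormsDeg_le_polyForms _ _ _ hη⟩
  exact ⟨k, ⟨Brieskorn.mk f θ, Submodule.mem_map_of_mem hη⟩, degMap_mk hd hf hn k hη⟩

/-- The pole order description of the cohomology of `(df/f) ∧ Ω^•[f⁻¹]_0^{(ξ)}` in top degree. -/
lemma exists_cohomology_equiv_limit (hd : 0 < d) (hf : f.IsHomogeneous d) (hn : 0 < n) :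
    ∃ e : Cohomology (dlogXiForms f d) (-formDeriv ℂ (PolyLoc f)) n ≃ₗ[ℂ] Brieskorn.Limit hf,
      ∀ (k : ℕ) (η : polyForms n (n + 1))
        (hη : (η : Forms ℂ (Poly n)) ∈ polyFormsDeg n (n + 1) (k * d)),
        ∃ h : divPow f k η ∈ cocycles (dlogXiForms f d) (-formDeriv ℂ (PolyLoc f)) n,
          e (Cohomology.mk _ _ n ⟨divPow f k η, h⟩) =
            Module.DirectLimit.of ℂ ℕ _ _ k ⟨Brieskorn.mk f η, Submodule.mem_map_of_mem hη⟩ := by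
  obtain ⟨e, he⟩ := exists_equiv_directLimit (K := ℂ)
    (G := fun k : ℕ => Brieskorn.deg f (k * d)) (T := Brieskorn.transition hf)
    (degMap hd hf hn) (degMap_transition hd hf hn)
    (exists_transition_eq_zero hd hf hn) (exists_degMap_eq hd hf hn)
  exact ⟨e, fun k η hη => ⟨(mem_cocycles_dlogXiForms_iff hd hf).mpr (divPow_mem_locFormsDeg hη),
    (congrArg e (degMap_mk hd hf hn k hη).symm).trans (he k _)⟩⟩

end SecondIsomorphism

end DeRham

end

theorem proposition1p5 (n d : ℕ) (hn : 2 ≤ n) (hd : 0 < d) (f : Poly n)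
    (hf : f.IsHomogeneous d) (hred : Squarefree f) :
    ∃ (e₁ : Cohomology (openForms (hypersurfaceCompl f)) (openFormDeriv (hypersurfaceCompl f)) n
          ≃ₗ[ℂ] Cohomology (dlogXiForms f d) (-formDeriv ℂ (PolyLoc f)) n)
      (e₂ : Cohomology (dlogXiForms f d) (-formDeriv ℂ (PolyLoc f)) n
          ≃ₗ[ℂ] Brieskorn.Limit hf),
      (∀ ω : cocycles (openForms (hypersurfaceCompl f)) (openFormDeriv (hypersurfaceCompl f)) n,
        pullbackForm hf hd ω ∈ xiForms f d n ∧
        ∃ h : dlog f * pullbackForm hf hd ω ∈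
            cocycles (dlogXiForms f d) (-formDeriv ℂ (PolyLoc f)) n,
          e₁ (Cohomology.mk _ _ n ω) = Cohomology.mk _ _ n ⟨dlog f * pullbackForm hf hd ω, h⟩) ∧
      (∀ (k : ℕ) (η : polyForms n (n + 1))
        (hη : (η : Forms ℂ (Poly n)) ∈ polyFormsDeg n (n + 1) (k * d)),
        ∃ h : divPow f k η ∈ cocycles (dlogXiForms f d) (-formDeriv ℂ (PolyLoc f)) n,
          e₂ (Cohomology.mk _ _ n ⟨divPow f k η, h⟩) =
            Module.DirectLimit.of ℂ ℕ _ _ k ⟨Brieskorn.mk f η, Submodule.mem_map_of_mem hη⟩) := by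
  exact (exists_openForms_cohomology_equiv hd hf n).elim fun e₁ he₁ =>
    (exists_cohomology_equiv_limit hd hf (by omega : 0 < n)).elim fun e₂ he₂ =>
      ⟨e₁, e₂, fun ω => ⟨pullbackForm_mem_xiForms hd hf ω.2.1, he₁ ω⟩, he₂⟩
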